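/- **Setting.** Let $P$ be a smooth $2m$-dimensional manifold (Hausdorff, second countable, without boundary) with a smooth $1$-form $\lambda$ such that $d\lambda$ is symplectic. Let $\mathcal C(P)=P\times\mathbb R$ with contact form $\alpha=dz-\lambda$, and $X=\mathbb R\times\mathcal C(P)$ with symplectic form $\omega=d(e^s\alpha)$. A *closed Legendrian* is a compact embedded $m$-dimensional submanifold $\Lambda\subset\mathcal C(P)$ without boundary with $\alpha|_\Lambda=0$. For closed Legendrians $\Lambda_\pm$ and $s_-\le s_+$, a *Lagrangian cobordism from $\Lambda_-$ to $\Lambda_+$, cylindrical outside $[s_-,s_+]$*, is a closed subset $L\subset X$ that is an embedded Lagrangian submanifold such that $L\cap([s_-,s_+]\times\mathcal C(P))$ is compact, $$L\cap((-\infty,s_-]\times\mathcal C(P))=(-\infty,s_-]\times\Lambda_-,\qquad L\cap([s_+,\infty)\times\mathcal C(P))=[s_+,\infty)\times\Lambda_+,$$ and such that there are a constant $C_+$ and a smooth function $f$ on $L$ with $e^s\alpha|_L=df$, $f=0$ on $(-\infty,s_-]\times\Lambda_-$ and $f=C_+$ on $[s_+,\infty)\times\Lambda_+$. (Neither orientability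 nor vanishing of the Maslov class is needed.) For $L\subset X$ and $-\infty\le a<b\le\infty$ put $L_a^b=L\cap((a,b)\times\mathcal C(P))$. Its *relative Gromov width* $w(L_a^b)\in[0,\infty]$ is the supremum (equal to $0$ for the empty set) of $\pi r^2$ over all $r>0$ for which there is a smooth embedding $\psi$ of the closed ball $B^{2m+2}(r)\subset\mathbb R^{m+1}\times\mathbb R^{m+1}$ into $(a,b)\times\mathcal C(P)$ with $\psi^*\omega=\sum_i dx_i\wedge dy_i$ and $\psi^{-1}(L_a^b)=B^{2m+2}(r)\cap\{y=0\}$. **Theorem.** 1. Let $L$ be a Lagrangian cobordism from $\Lambda_-$ to $\Lambda_+$ that is cylindrical outside $[s_-,0]$. Let $a<b\le 0$ and let $\Lambda\subset\mathcal C(P)$ be a closed Legendrian with $$L\cap([a,b]\times\mathcal C(P))=[a,b]\times\Lambda .$$ Assume that $\Lambda$ is connected or, more generally, that some smooth $f$ on $L$ with $df=e^s\alpha|_L$ vanishes on $(-\infty,s_-]\times\Lambda_-$ and is constant on $[a,b]\times\Lambda$. Then $$w\big((\mathbb R\times\Lambda)_{-\infty}^b\big)\le w\big(L_{-\infty}^0\big).$$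 2. For every closed Legendrian $\Lambda$ and every $b\in\mathbb R$, $\;w\big((\mathbb R\times\Lambda)_{-\infty}^b\big)=e^b\,w\big((\mathbb R\times\Lambda)_{-\infty}^0\big)$. 3. If $L$ is a Lagrangian cobordism from $\Lambda_-$ to $\Lambda_+$ that is cylindrical outside $[s_-,0]$, then $$e^{s_-}\,w\big((\mathbb R\times\Lambda_-)_{-\infty}^0\big)\le w\big(L_{-\infty}^0\big).$$ 4. If $L$ is a Lagrangian cobordism from $\Lambda_-$ to $\Lambda_+$ that is cylindrical outside $[s_-,-\epsilon]$ for some $\epsilon>0$, then $$w\big((\mathbb R\times\Lambda_+)_{-\infty}^0\big)\le w\big(L_{-\infty}^0\big).$$ -/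

import Mathlib

open scoped Manifold ContDiff ENNReal Topology

noncomputable section

section Forms

variable {E : Type*} [NormedAddCommGroup E] [NormedSpace ℝ E]
  {H : Type*} [TopologicalSpace H] (I : ModelWithCorners ℝ E H)
  {M : Type*} [TopologicalSpace M] [ChartedSpace H M]

/-- A (not necessarily smooth) field of covectors on `M`. -/
abbrev OneForm (M : Type*) [TopologicalSpace M] [ChartedSpace H M] :=
  (x : M) → (TangentSpace I x →L[ℝ] ℝ)

/-- The expression of a 1-form in the preferred chart `φ` at `p`, that is, its pullback under
`φ⁻¹`. -/
def OneForm.inChart (θ : OneForm I M) (p : M) (y : E) : E →L[ℝ] ℝ :=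
  (θ ((extChartAt I p).symm y)).comp (mfderiv 𝓘(ℝ, E) I (extChartAt I p).symm y)

/-- Smoothness of a 1-form: its expression in every preferred chart is smooth. -/
def OneForm.IsSmooth (θ : OneForm I M) : Prop :=
  ∀ p : M, ContDiffOn ℝ ∞ (OneForm.inChart I θ p) (extChartAt I p).target

/-- The exterior derivative `dθ` at `p`, evaluated on `u, v`: in the preferred chart at `p` it is
`(dθ)(u, v) = (D_u θ)(v) - (D_v θ)(u)`. -/
def OneForm.d (θ : OneForm I M) (p : M) (u v : TangentSpace I p) : ℝ :=
  let φ := extChartAt I p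
  let u' : E := mfderiv I 𝓘(ℝ, E) φ p u
  let v' : E := mfderiv I 𝓘(ℝ, E) φ p v
  fderiv ℝ (OneForm.inChart I θ p) (φ p) u' v' - fderiv ℝ (OneForm.inChart I θ p) (φ p) v' u'

/-- `S` is an embedded smooth submanifold of dimension `d` (without boundary): around each of its
points there is a chart of the maximal smooth atlas in which `S` is a linear slice. -/
def IsSmoothSubmanifold (d : ℕ) (S : Set M) : Prop :=
  ∀ x ∈ S, ∃ e ∈ IsManifold.maximalAtlas I ∞ M, x ∈ e.source ∧
    ∃ W : Submodule ℝ E, Module.finrank ℝ W = d ∧ ∀ y ∈ e.source, (y ∈ S ↔ I (e y) ∈ W)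

/-- The tangent space of `S` at `x`: the velocities at time `0` of smooth curves in `S` that pass
through `x` at time `0`. -/
def tangentTo (S : Set M) (x : M) : Set (TangentSpace I x) :=
  {v | ∃ γ : ℝ → M, ContMDiff 𝓘(ℝ, ℝ) I ∞ γ ∧ (∀ t, γ t ∈ S) ∧ γ 0 = x ∧
    (mfderiv 𝓘(ℝ, ℝ) I γ 0 (1 : ℝ) : E) = (v : E)}

end Forms

section Symplectization

/-- The model of a `2m`-dimensional manifold `P`, of `𝒞(P) = P × ℝ`, and of `ℝ × 𝒞(P)`. -/
abbrev modelP (m : ℕ) := 𝓡 (2 * m)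

abbrev modelC (m : ℕ) := (modelP m).prod 𝓘(ℝ, ℝ)

abbrev modelX (m : ℕ) := (𝓘(ℝ, ℝ)).prod (modelC m)

variable {m : ℕ} {P : Type*} [TopologicalSpace P]
  [ChartedSpace (EuclideanSpace ℝ (Fin (2 * m))) P]

/-- `lam` is a smooth 1-form on `P` whose exterior derivative is symplectic. -/
structure IsLiouvilleForm (lam : OneForm (modelP m) P) : Prop where
  smooth : OneForm.IsSmooth (modelP m) lam
  nondegenerate : ∀ (p : P) (u : TangentSpace (modelP m) p),
    (∀ v : TangentSpace (modelP m) p, OneForm.d (modelP m) lam p u v = 0) → u = 0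

/-- The contact form `α = dz - λ` on the contactization `P × ℝ`. -/
def contactForm (lam : OneForm (modelP m) P) : OneForm (modelC m) (P × ℝ) := fun q =>
  let dz : TangentSpace (modelC m) q →L[ℝ] ℝ :=
    mfderiv (modelC m) 𝓘(ℝ, ℝ) (Prod.snd : P × ℝ → ℝ) q
  dz - (lam q.1).comp (mfderiv (modelC m) (modelP m) (Prod.fst : P × ℝ → P) q)

/-- The 1-form `e^s α` on the symplectization `ℝ × (P × ℝ)`. -/
def sympPrimitive (lam : OneForm (modelP m) P) : OneForm (modelX m) (ℝ × (P × ℝ)) := fun x =>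
  Real.exp x.1 • (contactForm lam x.2).comp
    (mfderiv (modelX m) (modelC m) (Prod.snd : ℝ × (P × ℝ) → P × ℝ) x)

/-- The symplectic form `ω = d(e^s α)`. -/
def sympForm (lam : OneForm (modelP m) P) (x : ℝ × (P × ℝ))
    (u v : TangentSpace (modelX m) x) : ℝ :=
  OneForm.d (modelX m) (sympPrimitive lam) x u v

/-- A closed (compact, without boundary) Legendrian submanifold of `P × ℝ`, where `P` has
dimension `2m`. -/
structure IsClosedLegendrian (lam : OneForm (modelP m) P) (Lam : Set (P × ℝ)) : Prop where
  compact : IsCompact Lam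
  submanifold : IsSmoothSubmanifold (modelC m) m Lam
  tangent : ∀ q ∈ Lam, ∀ v ∈ tangentTo (modelC m) Lam q, contactForm lam q v = 0

/-- A Lagrangian submanifold of the symplectization (which has dimension `2m + 2`). -/
structure IsLagrangian (lam : OneForm (modelP m) P) (L : Set (ℝ × (P × ℝ))) : Prop where
  submanifold : IsSmoothSubmanifold (modelX m) (m + 1) L
  isotropic : ∀ x ∈ L, ∀ u ∈ tangentTo (modelX m) L x, ∀ v ∈ tangentTo (modelX m) L x,
    sympForm lam x u v = 0

/-- `f` restricts to a smooth function on `L` with `e^s α|_L = df`. (The sets `L` to which this is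
applied are closed submanifolds, so every smooth function on `L` is such a restriction.) -/
structure IsPrimitiveOn (lam : OneForm (modelP m) P) (L : Set (ℝ × (P × ℝ)))
    (f : ℝ × (P × ℝ) → ℝ) : Prop where
  smooth : ContMDiff (modelX m) 𝓘(ℝ, ℝ) ∞ f
  deriv_eq : ∀ x ∈ L, ∀ v ∈ tangentTo (modelX m) L x,
    (mfderiv (modelX m) 𝓘(ℝ, ℝ) f x v : ℝ) = sympPrimitive lam x v

/-- `L` is an exact Lagrangian cobordism from `Lam₋` to `Lam₊` that is cylindrical outside
`[s₋, s₊]`. Orientability and vanishing of the Maslov class are not demanded, so this class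
contains the orientable Maslov zero cobordisms. -/
structure IsLagrangianCobordism (lam : OneForm (modelP m) P) (Lamneg Lampos : Set (P × ℝ))
    (sneg spos : ℝ) (L : Set (ℝ × (P × ℝ))) : Prop where
  le : sneg ≤ spos
  legendrian_neg : IsClosedLegendrian lam Lamneg
  legendrian_pos : IsClosedLegendrian lam Lampos
  lagrangian : IsLagrangian lam L
  closed : IsClosed L
  compact_middle : IsCompact (L ∩ {x | x.1 ∈ Set.Icc sneg spos})
  cylinder_neg : L ∩ (Set.Iic sneg ×ˢ Set.univ) = Set.Iic sneg ×ˢ Lamneg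
  cylinder_pos : L ∩ (Set.Ici spos ×ˢ Set.univ) = Set.Ici spos ×ˢ Lampos
  exact : ∃ (f : ℝ × (P × ℝ) → ℝ) (Cpos : ℝ), IsPrimitiveOn lam L f ∧
    (∀ x ∈ L, x.1 ≤ sneg → f x = 0) ∧ (∀ x ∈ L, spos ≤ x.1 → f x = Cpos)

/-- The slab `(a, b) × 𝒞(P)`, for `-∞ ≤ a` and `b ≤ ∞`. -/
def slab (P : Type*) (a b : EReal) : Set (ℝ × (P × ℝ)) :=
  {x | a < (x.1 : EReal) ∧ (x.1 : EReal) < b}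

/-- `ℝ^N × ℝ^N` with its Euclidean norm; coordinates `x_i` (`Sum.inl i`), `y_i` (`Sum.inr i`). -/
abbrev StdSpace (N : ℕ) := EuclideanSpace ℝ (Fin N ⊕ Fin N)

/-- The standard symplectic form `∑ dx_i ∧ dy_i`. -/
def stdForm {N : ℕ} (u v : StdSpace N) : ℝ :=
  ∑ i : Fin N, (u (Sum.inl i) * v (Sum.inr i) - u (Sum.inr i) * v (Sum.inl i))

/-- The real plane `{y = 0}`. -/
def realPlane (N : ℕ) : Set (StdSpace N) := {x | ∀ i : Fin N, x (Sum.inr i) = 0}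

/-- `ψ` restricts to a symplectic embedding of the closed ball of radius `r` into the slab
`(a, b) × 𝒞(P)` relative to `L_a^b = L ∩ ((a, b) × 𝒞(P))`. (An injective smooth map on the compact
ball that pulls `ω` back to the standard form is an immersion, hence an embedding.) -/
structure IsRelSymplecticEmbedding (lam : OneForm (modelP m) P) (a b : EReal)
    (L : Set (ℝ × (P × ℝ))) (r : ℝ) (ψ : StdSpace (m + 1) → ℝ × (P × ℝ)) : Prop where
  smooth : ContMDiffOn 𝓘(ℝ, StdSpace (m + 1)) (modelX m) ∞ ψ (Metric.closedBall 0 r)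
  injOn : Set.InjOn ψ (Metric.closedBall 0 r)
  mapsTo : Set.MapsTo ψ (Metric.closedBall 0 r) (slab P a b)
  symplectic : ∀ x ∈ Metric.closedBall (0 : StdSpace (m + 1)) r, ∀ u v : StdSpace (m + 1),
    sympForm lam (ψ x)
      (mfderivWithin 𝓘(ℝ, StdSpace (m + 1)) (modelX m) ψ (Metric.closedBall 0 r) x u)
      (mfderivWithin 𝓘(ℝ, StdSpace (m + 1)) (modelX m) ψ (Metric.closedBall 0 r) x v) =
        stdForm u v
  relative : Metric.closedBall 0 r ∩ ψ ⁻¹' (L ∩ slab P a b) =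
    Metric.closedBall 0 r ∩ realPlane (m + 1)

/-- The relative Gromov width `w(L_a^b) ∈ [0, ∞]`. -/
def relWidth (lam : OneForm (modelP m) P) (a b : EReal) (L : Set (ℝ × (P × ℝ))) : ℝ≥0∞ :=
  sSup {c | ∃ r : ℝ, 0 < r ∧ (∃ ψ, IsRelSymplecticEmbedding lam a b L r ψ) ∧
    c = ENNReal.ofReal (Real.pi * r ^ 2)}

/-- The cylinder `ℝ × Lam`. -/
def cyl (Lam : Set (P × ℝ)) : Set (ℝ × (P × ℝ)) := Set.univ ×ˢ Lam

end Symplectization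

end

/-! The aim is to straighten `L` below the cylindrical piece: to find symplectic maps that pull `L`
back to `ℝ × Λ` between an arbitrarily low level and `b`, and do not push points below `b` above it.
Any relative ball for the cylinder is compact, so such a map carries it to a relative ball for `L`
of the same radius.

Exactness supplies the maps. Let `f` be a primitive of `e^s α` on `L`, extend it from the part of
`L` below `b` to a function `h` on the symplectization, and define `Z` by `ι_Z ω = e^s α - dh`. By
Cartan's formula the Lie derivative of `ω` along `Z` is `ω`, so the flow `F_t` multiplies `ω` by
`e^t` (`exists_flowOn`). On tangent vectors of `L` the form `ι_Z ω` vanishes, and a Lagrangian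
tangent space is its own symplectic complement; hence `Z` is tangent to `L` and its flow preserves
`L` below `b` (`mem_lagrangian_of_integralCurve`). Because `f` is constant on the piece, `h` can be
made constant above some level `a'` inside `(a, b)`, where `Z = ∂_s`. Because `f` vanishes on the
negative end, `h` can be made a function of `s` alone off a compact set (`exists_hamiltonian`),
where the flow is an explicit shear; so the flow exists everywhere for a uniform time
(`exists_uniform_flow`).

Write `τ_T` for translation by `T` in `s`, which multiplies `ω` by `e^T`. Then `Φ = F_{-T} ∘ τ_T` is
symplectic, is the identity above `a'`, and carries `τ_T⁻¹(L)` to `L` below `b - T`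
(`exists_slide`). Iterating `Ψ ↦ Φ ∘ τ_{-T} ∘ Ψ ∘ τ_T` lowers the straightened range by `T` each
time (`exists_iterated_slide`), and `relWidth_cyl_le` follows.

The scaling law combines a translation with a dilation of the ball. The comparisons with the two
ends apply the main inequality to pieces of those ends, where the primitive is constant by
definition. The smooth dependence of flows on initial values is derived from the inverse function
theorem on a space of curves (`exists_smooth_local_flow`). -/

noncomputable section

set_option linter.unusedSectionVars false

/-! ### Composition operators on spaces of continuous maps -/

section Superposition

variable {K : Type*} [TopologicalSpace K] [CompactSpace K]
universe w

/-- Pointwise application of a field of continuous linear maps to a field of vectors. -/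
def pointwiseApplyL (K : Type*) [TopologicalSpace K] [CompactSpace K] (E F : Type*)
    [NormedAddCommGroup E] [NormedSpace ℝ E] [NormedAddCommGroup F] [NormedSpace ℝ F] :
    C(K, E →L[ℝ] F) →L[ℝ] C(K, E) →L[ℝ] C(K, F) :=
  LinearMap.mkContinuous₂
    (LinearMap.mk₂ ℝ (fun (A : C(K, E →L[ℝ] F)) (h : C(K, E)) =>
        (⟨fun t => A t (h t), A.continuous.clm_apply h.continuous⟩ : C(K, F)))
      (fun A B h => by ext t; simp) (fun c A h => by ext t; simp)
      (fun A h k => by ext t; simp) (fun c A h => by ext t; simp)) 1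
    (fun A h => by
      refine (ContinuousMap.norm_le _ (by positivity)).2 fun t => ?_
      simp only [LinearMap.mk₂_apply, ContinuousMap.coe_mk, one_mul]
      exact ((A t).le_opNorm _).trans
        (mul_le_mul (A.norm_coe_le_norm t) (h.norm_coe_le_norm t) (norm_nonneg _)
          (norm_nonneg A)))

@[simp] lemma pointwiseApplyL_apply {E F : Type*}
    [NormedAddCommGroup E] [NormedSpace ℝ E] [NormedAddCommGroup F] [NormedSpace ℝ F]
    (A : C(K, E →L[ℝ] F)) (h : C(K, E)) (t : K) :
    pointwiseApplyL K E F A h t = A t (h t) := rfl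

/-- The superposition operator `γ ↦ v ∘ γ`. -/
def superposition {E F : Type*} [NormedAddCommGroup E] [NormedAddCommGroup F]
    (v : C(E, F)) (γ : C(K, E)) : C(K, F) := v.comp γ

/-- Continuity of `superposition v'` in the sup norm makes `v'` vary by at most `ε` along all
segments from `γ t` to `γ t + h t` at once. The mean value inequality then bounds the remainder by
`ε ‖h‖` uniformly in `t`. -/
lemma hasFDerivAt_superposition {E F : Type*}
    [NormedAddCommGroup E] [NormedSpace ℝ E] [NormedAddCommGroup F] [NormedSpace ℝ F]
    (v : C(E, F)) (v' : C(E, E →L[ℝ] F)) (hv : ∀ x, HasFDerivAt v (v' x) x) (γ : C(K, E)) :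
    HasFDerivAt (superposition v : C(K, E) → C(K, F))
      (pointwiseApplyL K E F (superposition v' γ)) γ := by
  rw [hasFDerivAt_iff_isLittleO_nhds_zero, Asymptotics.isLittleO_iff]
  intro ε hε
  have hc : ContinuousAt (superposition v' : C(K, E) → _) γ :=
    (ContinuousMap.continuous_postcomp v').continuousAt
  obtain ⟨δ, hδ, H⟩ := Metric.continuousAt_iff.1 hc ε hε
  filter_upwards [Metric.ball_mem_nhds (0 : C(K, E)) hδ] with h hh
  rw [mem_ball_zero_iff] at hh
  refine (ContinuousMap.norm_le _ (by positivity)).2 fun t => ?_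
  have key : ∀ y ∈ segment ℝ (γ t) (γ t + h t), ‖v' y - v' (γ t)‖ ≤ ε := by
    rintro y hy
    rw [segment_eq_image'] at hy
    obtain ⟨r, ⟨hr0, hr1⟩, rfl⟩ := hy
    have h1 : dist (γ + r • h) γ < δ := by
      rw [dist_eq_norm, add_sub_cancel_left, norm_smul, Real.norm_of_nonneg hr0]
      exact (mul_le_of_le_one_left (norm_nonneg _) hr1).trans_lt hh
    have h2 := H h1
    have h3 := ContinuousMap.dist_apply_le_dist (f := superposition v' (γ + r • h))
      (g := superposition v' γ) t
    rw [dist_eq_norm] at h3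
    simpa [superposition] using (h3.trans h2.le)
  have := (convex_segment (γ t) (γ t + h t)).norm_image_sub_le_of_norm_hasFDerivWithin_le'
    (f := v) (f' := v') (φ := v' (γ t)) (C := ε)
    (fun y _ => (hv y).hasFDerivWithinAt) key (left_mem_segment ℝ _ _) (right_mem_segment ℝ _ _)
  simp only [add_sub_cancel_left] at this
  calc _ = ‖v (γ t + h t) - v (γ t) - v' (γ t) (h t)‖ := by simp [superposition]
    _ ≤ ε * ‖h t‖ := this
    _ ≤ ε * ‖h‖ := by gcongr; exact h.norm_coe_le_norm t

/-- Induction on `n`: the derivative is the superposition operator of `fderiv ℝ v` followed by the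
bounded map `pointwiseApplyL`. The target must vary in the induction, since `fderiv ℝ v` takes
values in `E →L[ℝ] F`; this is why both spaces share a universe. -/
lemma contDiff_superposition {E : Type w} [NormedAddCommGroup E] [NormedSpace ℝ E] (n : ℕ) :
    ∀ {F : Type w} [NormedAddCommGroup F] [NormedSpace ℝ F] (v : C(E, F)),
    ContDiff ℝ n v → ContDiff ℝ n (superposition v : C(K, E) → C(K, F)) := by
  induction n with
  | zero =>
    intro F _ _ v _
    exact contDiff_zero.2 (ContinuousMap.continuous_postcomp v)
  | succ n ih =>
    intro F _ _ v hv
    have hv' : ContDiff ℝ n (fderiv ℝ v) := hv.fderiv_right (by norm_cast)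
    have hd : ∀ x, HasFDerivAt v (fderiv ℝ v x) x := fun x =>
      ((hv.differentiable (by norm_cast)) x).hasFDerivAt
    rw [show ((n + 1 : ℕ) : WithTop ℕ∞) = (n : WithTop ℕ∞) + 1 by norm_cast,
      contDiff_succ_iff_hasFDerivAt]
    · refine ⟨_, (pointwiseApplyL K E F).contDiff.comp
        (ih (⟨fderiv ℝ v, hv'.continuous⟩ : C(E, E →L[ℝ] F)) hv'), fun γ => ?_⟩
      exact hasFDerivAt_superposition v ⟨fderiv ℝ v, hv'.continuous⟩ hd γ

lemma contDiff_infty_superposition {E F : Type w} [NormedAddCommGroup E] [NormedSpace ℝ E]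
    [NormedAddCommGroup F] [NormedSpace ℝ F] (v : C(E, F)) (hv : ContDiff ℝ ∞ v) :
    ContDiff ℝ ∞ (superposition v : C(K, E) → C(K, F)) :=
  contDiff_infty.2 fun n => contDiff_superposition n v (contDiff_infty.1 hv n)

end Superposition

/-! ### Smooth dependence of local flows on the initial value -/

section LocalFlow

variable {E : Type*} [NormedAddCommGroup E] [NormedSpace ℝ E]

/-- The interval `[-1, 1]` as a type. -/
abbrev TimeInterval : Type := Set.Icc (-1 : ℝ) 1

/-- The projection of `ℝ` onto `[-1, 1]`. -/
def clampTime (t : ℝ) : TimeInterval := Set.projIcc (-1 : ℝ) 1 (by norm_num) t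

lemma continuous_clampTime : Continuous clampTime :=
  continuous_projIcc (h := by norm_num)

lemma coe_clampTime {t : ℝ} (ht : t ∈ Set.Icc (-1 : ℝ) 1) : (clampTime t : ℝ) = t := by
  simp [clampTime, Set.projIcc_of_mem _ ht]

/-- Integration from `0` as an operator on continuous curves. -/
def integrateL (E : Type*) [NormedAddCommGroup E] [NormedSpace ℝ E] :
    C(TimeInterval, E) →L[ℝ] C(TimeInterval, E) :=
  LinearMap.mkContinuous
    { toFun := fun γ => ⟨fun τ => ∫ r in (0 : ℝ)..τ, γ (clampTime r),
        (intervalIntegral.continuous_primitive (fun a b =>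
          (γ.continuous.comp continuous_clampTime).intervalIntegrable a b) 0).comp
          continuous_subtype_val⟩
      map_add' := fun γ β => by
        ext τ
        exact intervalIntegral.integral_add
          ((γ.continuous.comp continuous_clampTime).intervalIntegrable _ _)
          ((β.continuous.comp continuous_clampTime).intervalIntegrable _ _)
      map_smul' := fun c γ => by
        ext τ
        exact intervalIntegral.integral_smul c _ } 1
    (fun γ => by
      refine (ContinuousMap.norm_le _ (by positivity)).2 fun τ => ?_
      have h := intervalIntegral.norm_integral_le_of_norm_le_const (a := (0 : ℝ)) (b := τ)
        (f := fun r => γ (clampTime r)) (C := ‖γ‖) (fun r _ => γ.norm_coe_le_norm _)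
      have h2 : |(τ : ℝ) - 0| ≤ 1 := by
        rw [sub_zero]; exact abs_le.2 τ.2
      calc _ ≤ ‖γ‖ * |(τ : ℝ) - 0| := h
        _ ≤ ‖γ‖ * 1 := by gcongr
        _ = 1 * ‖γ‖ := by ring)

lemma integrateL_apply (γ : C(TimeInterval, E)) (τ : TimeInterval) :
    integrateL E γ τ = ∫ r in (0 : ℝ)..τ, γ (clampTime r) := rfl

/-- A constant curve, as a linear function of its value. -/
def constL (E : Type*) [NormedAddCommGroup E] [NormedSpace ℝ E] : E →L[ℝ] C(TimeInterval, E) :=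
  LinearMap.mkContinuous
    { toFun := fun x => ContinuousMap.const _ x
      map_add' := fun _ _ => rfl
      map_smul' := fun _ _ => rfl } 1
    (fun x => by
      refine (ContinuousMap.norm_le _ (by positivity)).2 fun τ => ?_
      rw [one_mul]
      exact le_refl ‖x‖)

@[simp] lemma constL_apply (x : E) (τ : TimeInterval) : constL E x τ = x := rfl

/-- Curves live on the fixed interval `[-1, 1]` and real time is `t = T τ`; the chain rule cancels
the factor `T`. The integrand `β` is arbitrary so that both the equation and its linearization are
covered. -/
lemma hasDerivAt_of_eq_integral [CompleteSpace E] {γ β : C(TimeInterval, E)} {x : E} {T : ℝ}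
    (hT : 0 < T) (h : γ = constL E x + T • integrateL E β) {t : ℝ} (ht : t ∈ Set.Ioo (-T) T) :
    HasDerivAt (fun s => γ (clampTime (s / T))) (β (clampTime (t / T))) t := by
  have h1 : ∀ s ∈ Set.Ioo (-T) T, γ (clampTime (s / T)) =
      x + T • ∫ r in (0 : ℝ)..(s / T), β (clampTime r) := by
    intro s hs
    have hs' : s / T ∈ Set.Icc (-1 : ℝ) 1 := by
      constructor
      · rw [le_div_iff₀ hT]; linarith [hs.1]
      · rw [div_le_iff₀ hT]; linarith [hs.2]
    rw [h]
    simp only [ContinuousMap.add_apply, ContinuousMap.smul_apply, constL_apply, integrateL_apply,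
      coe_clampTime hs']
  have hcont : Continuous fun r => β (clampTime r) := β.continuous.comp continuous_clampTime
  have h2 : HasDerivAt (fun s => x + T • ∫ r in (0 : ℝ)..(s / T), β (clampTime r))
      (β (clampTime (t / T))) t := by
    have h3 := (hcont.integral_hasStrictDerivAt 0 (t / T)).hasDerivAt
    have h4 : HasDerivAt (fun s : ℝ => s / T) (1 / T) t := (hasDerivAt_id t).div_const T
    have h5 := ((HasDerivAt.scomp (𝕜 := ℝ) t h3 h4).const_smul T).const_add x
    convert! h5 using 1
    rw [smul_smul, mul_one_div_cancel hT.ne', one_smul]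
  refine h2.congr_of_eventuallyEq ?_
  filter_upwards [Ioo_mem_nhds ht.1 ht.2] with s hs using h1 s hs

/-- The map whose zeros in the last component are the solutions of `γ' = c v(γ)`, `γ(0) = x`. -/
def odeMap (v : C(E, E)) (p : E × ℝ × C(TimeInterval, E)) : E × ℝ × C(TimeInterval, E) :=
  (p.1, p.2.1, p.2.2 - constL E p.1 - p.2.1 • integrateL E (superposition v p.2.2))

lemma contDiff_odeMap (v : C(E, E)) (hv : ContDiff ℝ ∞ v) : ContDiff ℝ ∞ (odeMap v) := by
  have h := contDiff_infty_superposition (K := TimeInterval) v hv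
  unfold odeMap
  refine contDiff_fst.prodMk ((contDiff_fst.comp contDiff_snd).prodMk ?_)
  refine ((contDiff_snd.comp contDiff_snd).sub ((constL E).contDiff.comp contDiff_fst)).sub ?_
  exact (contDiff_fst.comp contDiff_snd).smul
    ((integrateL E).contDiff.comp (h.comp (contDiff_snd.comp contDiff_snd)))

/-- The derivative of `odeMap` at `(x₀, 0, const)`. -/
def odeMapDeriv (w : C(TimeInterval, E)) :
    (E × ℝ × C(TimeInterval, E)) ≃L[ℝ] (E × ℝ × C(TimeInterval, E)) :=
  let a : (E × ℝ × C(TimeInterval, E)) →L[ℝ] C(TimeInterval, E) :=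
    (constL E).comp (ContinuousLinearMap.fst ℝ _ _) +
      ((ContinuousLinearMap.fst ℝ ℝ C(TimeInterval, E)).comp
        (ContinuousLinearMap.snd ℝ E _)).smulRight w
  let l : (E × ℝ × C(TimeInterval, E)) →L[ℝ] C(TimeInterval, E) :=
    (ContinuousLinearMap.snd ℝ ℝ C(TimeInterval, E)).comp (ContinuousLinearMap.snd ℝ E _)
  let p : (E × ℝ × C(TimeInterval, E)) →L[ℝ] ℝ :=
    (ContinuousLinearMap.fst ℝ ℝ C(TimeInterval, E)).comp (ContinuousLinearMap.snd ℝ E _)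
  ContinuousLinearEquiv.equivOfInverse
    ((ContinuousLinearMap.fst ℝ E _).prod (p.prod (l - a)))
    ((ContinuousLinearMap.fst ℝ E _).prod (p.prod (l + a)))
    (fun z => by ext <;> simp [a, l, p]) (fun z => by ext <;> simp [a, l, p])

/-- At time scale `0` the integral term does not contribute to the derivative in `γ`. The derivative
is therefore triangular, with an explicit inverse. -/
lemma hasFDerivAt_odeMap (v : C(E, E)) (hv : ContDiff ℝ ∞ v) (x₀ : E) :
    HasFDerivAt (odeMap v)
      (odeMapDeriv (integrateL E (superposition v (constL E x₀))) :
        (E × ℝ × C(TimeInterval, E)) →L[ℝ] _) (x₀, 0, constL E x₀) := by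
  have h := (contDiff_infty_superposition (K := TimeInterval) v hv).differentiable (by simp)
  have e1 : HasFDerivAt (fun p : E × ℝ × C(TimeInterval, E) => p.2.1)
    ((ContinuousLinearMap.fst ℝ ℝ C(TimeInterval, E)).comp (ContinuousLinearMap.snd ℝ E _))
    (x₀, 0, constL E x₀) := (hasFDerivAt_snd).fst
  have e2 : HasFDerivAt (fun p : E × ℝ × C(TimeInterval, E) => p.2.2)
    ((ContinuousLinearMap.snd ℝ ℝ C(TimeInterval, E)).comp (ContinuousLinearMap.snd ℝ E _))
    (x₀, 0, constL E x₀) := (hasFDerivAt_snd).snd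
  have e3 := (integrateL E).hasFDerivAt.comp _ 
    (HasFDerivAt.comp (x₀, (0 : ℝ), constL E x₀) (h (constL E x₀)).hasFDerivAt e2)
  have e4 := e1.smul e3
  have e5 := hasFDerivAt_fst.prodMk (e1.prodMk
    ((e2.sub ((constL E).hasFDerivAt.comp (x₀, (0 : ℝ), constL E x₀) hasFDerivAt_fst)).sub e4))
  refine e5.congr_fderiv ?_
  ext <;> simp [odeMapDeriv, Function.comp]

/-- The inverse function theorem applies to `odeMap` at `(x₀, 0, const)`. The local inverse on
points `(x, T, 0)`, with a fixed small `T > 0`, returns the solution curve from `x`, smoothly in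
`x`. -/
lemma exists_solution_curves [CompleteSpace E] (v : C(E, E)) (hv : ContDiff ℝ ∞ v) (x₀ : E)
    {δ : ℝ} (hδ : 0 < δ) :
    ∃ T > (0 : ℝ), ∃ U : Set E, IsOpen U ∧ x₀ ∈ U ∧ ∃ Γ : E → C(TimeInterval, E),
      ContDiffOn ℝ ∞ Γ U ∧ ∀ x ∈ U, ‖Γ x - constL E x₀‖ < δ ∧
        Γ x = constL E x + T • integrateL E (superposition v (Γ x)) := by
  set p₀ : E × ℝ × C(TimeInterval, E) := (x₀, 0, constL E x₀) with hp₀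
  have hsm := contDiff_odeMap v hv
  have hd := hasFDerivAt_odeMap v hv x₀
  set Φ := (hsm.contDiffAt (x := p₀)).toOpenPartialHomeomorph (odeMap v) hd (by simp) with hΦ
  have hΦc : (Φ : _ → _) = odeMap v := rfl
  have hval : odeMap v p₀ = (x₀, 0, 0) := by simp [odeMap, p₀]
  have hsrc : p₀ ∈ Φ.source :=
    (hsm.contDiffAt (x := p₀)).mem_toOpenPartialHomeomorph_source hd (by simp)
  have htgt : ((x₀, 0, 0) : E × ℝ × C(TimeInterval, E)) ∈ Φ.target := by
    rw [← hval]; exact Φ.map_source hsrc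
  have hsymm : Φ.symm (x₀, 0, 0) = p₀ := by
    rw [← hval]; exact Φ.left_inv hsrc
  -- Smoothness of the inverse on a neighbourhood needs an invertible derivative at each nearby
  -- point; invertible operators form an open set.
  have hinv : ∀ᶠ p in 𝓝 p₀, ∃ A : (E × ℝ × C(TimeInterval, E)) ≃L[ℝ] (E × ℝ × C(TimeInterval, E)),
      HasFDerivAt (odeMap v) (A : _ →L[ℝ] _) p := by
    have hc : ContinuousAt (fderiv ℝ (odeMap v)) p₀ :=
      (hsm.continuous_fderiv (by simp)).continuousAt
    have := hc.preimage_mem_nhds (by rw [hd.fderiv]; exact ContinuousLinearEquiv.nhds _)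
    filter_upwards [this] with p hp
    obtain ⟨A, hA⟩ := hp
    refine ⟨A, ?_⟩
    rw [hA]
    exact ((hsm.differentiable (by simp)) p).hasFDerivAt
  have hnear : ∀ᶠ p in 𝓝 p₀, ‖p.2.2 - constL E x₀‖ < δ := by
    have : ContinuousAt (fun p : E × ℝ × C(TimeInterval, E) => ‖p.2.2 - constL E x₀‖) p₀ := by
      fun_prop
    exact this.eventually_lt continuousAt_const (by simpa [p₀] using hδ)
  have hev : ∀ᶠ q in 𝓝 ((x₀, 0, 0) : E × ℝ × C(TimeInterval, E)), q ∈ Φ.target ∧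
      ‖(Φ.symm q).2.2 - constL E x₀‖ < δ ∧ ContDiffAt ℝ ∞ Φ.symm q := by
    have hcs := Φ.continuousAt_symm htgt
    rw [ContinuousAt, hsymm] at hcs
    filter_upwards [Φ.open_target.mem_nhds htgt, hcs.eventually hinv, hcs.eventually hnear]
      with q hq ⟨A, hA⟩ h2
    exact ⟨hq, h2, Φ.contDiffAt_symm hq hA hsm.contDiffAt⟩
  have hcont : Continuous (fun q : E × ℝ => ((q.1, q.2, 0) : E × ℝ × C(TimeInterval, E))) := by
    fun_prop
  have hev2 := (hcont.tendsto (x₀, 0)).eventually hev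
  rw [nhds_prod_eq, Filter.eventually_prod_iff] at hev2
  obtain ⟨pa, ha, pb, hb, hab⟩ := hev2
  obtain ⟨U, hU, hUo, hxU⟩ := mem_nhds_iff.1 ha
  obtain ⟨ε, hε, hball⟩ := Metric.mem_nhds_iff.1 hb
  have hT : pb (ε / 2) := hball (by
    rw [Metric.mem_ball, dist_zero_right, Real.norm_of_nonneg (by positivity)]; linarith)
  refine ⟨ε / 2, by positivity, U, hUo, hxU, fun x => (Φ.symm (x, ε / 2, 0)).2.2, ?_, ?_⟩
  · intro x hx
    have h3 := (hab (hU hx) hT).2.2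
    refine ContDiffAt.contDiffWithinAt ?_
    have h4 : ContDiffAt ℝ ∞ (fun x : E => ((x, ε / 2, 0) : E × ℝ × C(TimeInterval, E))) x := by
      fun_prop
    exact (contDiff_snd.comp contDiff_snd).contDiffAt.comp x (h3.comp x h4)
  · intro x hx
    obtain ⟨h1, h2, -⟩ := hab (hU hx) hT
    refine ⟨h2, ?_⟩
    have h3 : odeMap v (Φ.symm (x, ε / 2, 0)) = (x, ε / 2, 0) := Φ.right_inv h1
    simp only [odeMap, Prod.mk.injEq] at h3
    obtain ⟨h4, h5, h6⟩ := h3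
    rw [h4, h5, sub_sub, sub_eq_zero] at h6
    exact h6

/-- The local flow of a smooth vector field is smooth in the initial value, and its derivative
solves the variational equation. -/
theorem exists_smooth_local_flow [CompleteSpace E] (v : E → E) (hv : ContDiff ℝ ∞ v) (x₀ : E)
    {Ω : Set E} (hΩ : Ω ∈ 𝓝 x₀) :
    ∃ T > (0 : ℝ), ∃ U : Set E, IsOpen U ∧ x₀ ∈ U ∧ ∃ φ : ℝ → E → E,
      (∀ t, ContDiffOn ℝ ∞ (φ t) U) ∧ ∀ x ∈ U, φ 0 x = x ∧ ∀ t ∈ Set.Ioo (-T) T,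
        φ t x ∈ Ω ∧ HasDerivAt (fun s => φ s x) (v (φ t x)) t ∧
        ∀ u, HasDerivAt (fun s => fderiv ℝ (φ s) x u)
          (fderiv ℝ v (φ t x) (fderiv ℝ (φ t) x u)) t := by
  obtain ⟨δ, hδ, hball⟩ := Metric.mem_nhds_iff.1 hΩ
  set V : C(E, E) := ⟨v, hv.continuous⟩
  have hv' : ContDiff ℝ ∞ (fderiv ℝ v) := hv.fderiv_right (by simp)
  obtain ⟨T, hT, U, hUo, hxU, Γ, hΓ, H⟩ := exists_solution_curves V hv x₀ hδ
  have hev : ∀ τ, ∀ x ∈ U, HasFDerivAt (fun y => Γ y τ)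
      ((ContinuousMap.evalCLM ℝ τ).comp (fderiv ℝ Γ x)) x := fun τ x hx =>
    (ContinuousMap.evalCLM (M := E) ℝ τ).hasFDerivAt.comp x
      ((hΓ.contDiffAt (hUo.mem_nhds hx)).differentiableAt (by simp)).hasFDerivAt
  refine ⟨T, hT, U, hUo, hxU, fun t x => Γ x (clampTime (t / T)), fun t => ?_, ?_⟩
  · exact (ContinuousMap.evalCLM ℝ (clampTime (t / T))).contDiff.comp_contDiffOn hΓ
  · intro x hx
    obtain ⟨h1, h2⟩ := H x hx
    refine ⟨?_, fun t ht => ⟨hball ?_, ?_, fun u => ?_⟩⟩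
    · simp only [zero_div]
      rw [h2]
      simp [integrateL_apply, coe_clampTime (t := 0) (by norm_num)]
    · rw [Metric.mem_ball, dist_eq_norm]
      exact ((Γ x - constL E x₀).norm_coe_le_norm (clampTime (t / T))).trans_lt h1
    · exact hasDerivAt_of_eq_integral hT h2 ht
    · have hdΓ := ((hΓ.contDiffAt (hUo.mem_nhds hx)).differentiableAt (by simp)).hasFDerivAt
      have hs := (hasFDerivAt_superposition V ⟨fderiv ℝ v, hv'.continuous⟩
        (fun y => (hv.differentiable (by simp) y).hasFDerivAt) (Γ x)).comp x hdΓ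
      -- Differentiating the integral equation in `x` gives an integral equation for the derivative
      -- of `Γ`, which is the integrated variational equation.
      have hr := (constL E).hasFDerivAt.add (((integrateL E).hasFDerivAt.comp x hs).const_smul T)
      have hr' := hr.congr_of_eventuallyEq (f₁ := Γ) (by
        filter_upwards [hUo.mem_nhds hx] with y hy using (H y hy).2)
      have heq := DFunLike.congr_fun (hdΓ.unique hr') u
      have := hasDerivAt_of_eq_integral hT (x := u) heq ht
      simp only [(hev _ x hx).fderiv]
      exact this

end LocalFlow

/-! ### Exact 2-forms and tangent fields on a vector space -/

section LinearModel

variable {E : Type*} [NormedAddCommGroup E] [NormedSpace ℝ E]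

/-- Exchanging the arguments of a bilinear form, as a continuous linear map. -/
def flipFormL (E : Type*) [NormedAddCommGroup E] [NormedSpace ℝ E] :
    (E →L[ℝ] E →L[ℝ] ℝ) →L[ℝ] (E →L[ℝ] E →L[ℝ] ℝ) :=
  (ContinuousLinearMap.flipₗᵢ ℝ E E ℝ).toContinuousLinearEquiv.toContinuousLinearMap

lemma contDiff_flipFormL : ContDiff ℝ ∞ (fun B : E →L[ℝ] E →L[ℝ] ℝ => flipFormL E B) := by
  apply ContinuousLinearMap.contDiff

lemma two_le_infty : (2 : WithTop ℕ∞) ≤ (∞ : WithTop ℕ∞) := ENat.LEInfty.out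

/-- The exterior derivative of a 1-form on a vector space, as a bilinear form. -/
def extForm (β : E → E →L[ℝ] ℝ) (y : E) : E →L[ℝ] E →L[ℝ] ℝ :=
  fderiv ℝ β y - (fderiv ℝ β y).flip

@[simp] lemma extForm_apply (β : E → E →L[ℝ] ℝ) (y u v : E) :
    extForm β y u v = fderiv ℝ β y u v - fderiv ℝ β y v u := rfl

lemma contDiffAt_extForm {β : E → E →L[ℝ] ℝ} {y : E} (hβ : ContDiffAt ℝ ∞ β y) :
    ContDiffAt ℝ ∞ (extForm β) y := by
  have h : ContDiffAt ℝ ∞ (fderiv ℝ β) y := hβ.fderiv_right (by simp)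
  exact h.sub (contDiff_flipFormL.contDiffAt.comp y h)

lemma fderiv_extForm_apply {β : E → E →L[ℝ] ℝ} {y : E} (hβ : ContDiffAt ℝ ∞ β y) (w u v : E) :
    fderiv ℝ (extForm β) y w u v =
      fderiv ℝ (fderiv ℝ β) y w u v - fderiv ℝ (fderiv ℝ β) y w v u := by
  have h : DifferentiableAt ℝ (fderiv ℝ β) y :=
    (hβ.fderiv_right (m := ∞) (by simp)).differentiableAt (by simp)
  have hd : DifferentiableAt ℝ (extForm β) y := (contDiffAt_extForm hβ).differentiableAt (by simp)
  have ev : ∀ a b : E, HasFDerivAt (fun x => fderiv ℝ β x a b) _ y := fun a b =>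
    (h.hasFDerivAt.clm_apply (hasFDerivAt_const a y)).clm_apply (hasFDerivAt_const b y)
  have h1 := (hd.hasFDerivAt.clm_apply (hasFDerivAt_const u y)).clm_apply (hasFDerivAt_const v y)
  have h2 := DFunLike.congr_fun (h1.unique ((ev u v).sub (ev v u))) w
  simpa using h2

/-- This is `d(dβ) = 0`: the six second derivatives cancel in pairs by symmetry. -/
lemma fderiv_extForm_cyclic {β : E → E →L[ℝ] ℝ} {y : E} (hβ : ContDiffAt ℝ ∞ β y) (w u v : E) :
    fderiv ℝ (extForm β) y w u v + fderiv ℝ (extForm β) y u v w +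
      fderiv ℝ (extForm β) y v w u = 0 := by
  have hs : IsSymmSndFDerivAt ℝ β y := hβ.isSymmSndFDerivAt (by simpa using two_le_infty)
  simp only [fderiv_extForm_apply hβ]
  rw [hs w u, hs w v, hs u v]
  ring

/-- Exterior differentiation commutes with pullback. -/
lemma extForm_pullback {F : Type*} [NormedAddCommGroup F] [NormedSpace ℝ F]
    {β : F → F →L[ℝ] ℝ} {g : E → F} {y : E} (hβ : ContDiffAt ℝ ∞ β (g y))
    (hg : ContDiffAt ℝ ∞ g y) (u v : E) :
    extForm (fun x => (β (g x)).comp (fderiv ℝ g x)) y u v =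
      extForm β (g y) (fderiv ℝ g y u) (fderiv ℝ g y v) := by
  have hg1 := (hg.differentiableAt (by simp)).hasFDerivAt
  have hg2 := ((hg.fderiv_right (m := ∞) (by simp)).differentiableAt (by simp)).hasFDerivAt
  have hb := ((hβ.differentiableAt (by simp)).hasFDerivAt).comp y hg1
  have hs : IsSymmSndFDerivAt ℝ g y := hg.isSymmSndFDerivAt (by simpa using two_le_infty)
  have h := hb.clm_comp hg2
  have h' : HasFDerivAt (fun x => (β (g x)).comp (fderiv ℝ g x)) _ y := h
  rw [extForm_apply, h'.fderiv]
  simp [hs u v]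

/-- The Lie derivative of `dβ` along a field `z` with `ι_z dβ = β - dh` is `dβ`. -/
lemma lieDerivative_extForm {β : E → E →L[ℝ] ℝ} {z : E → E} {h : E → ℝ} {x : E}
    (hβ : ContDiffAt ℝ ∞ β x) (hz : ContDiffAt ℝ ∞ z x) (hh : ContDiffAt ℝ ∞ h x)
    (H : ∀ᶠ y in 𝓝 x, extForm β y (z y) = β y - fderiv ℝ h y) (u v : E) :
    fderiv ℝ (extForm β) x (z x) u v + extForm β x (fderiv ℝ z x u) v +
      extForm β x u (fderiv ℝ z x v) = extForm β x u v := by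
  have hB := ((contDiffAt_extForm hβ).differentiableAt (by simp)).hasFDerivAt
  have hz1 := (hz.differentiableAt (by simp)).hasFDerivAt
  have hb1 := (hβ.differentiableAt (by simp)).hasFDerivAt
  have hh2 := ((hh.fderiv_right (m := ∞) (by simp)).differentiableAt (by simp)).hasFDerivAt
  have h1 := hB.clm_apply hz1
  have h2 := (hb1.sub hh2).congr_of_eventuallyEq H
  have h3 := h1.unique h2
  have hs : IsSymmSndFDerivAt ℝ h x := hh.isSymmSndFDerivAt (by simpa using two_le_infty)
  -- The hypothesis `H` is differentiated along `u` and evaluated at `v`, and conversely. The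
  -- Hessian of `h` cancels in the difference, and closedness of `dβ` converts what remains into the
  -- Lie derivative.
  have e1 := DFunLike.congr_fun (DFunLike.congr_fun h3 u) v
  have e2 := DFunLike.congr_fun (DFunLike.congr_fun h3 v) u
  simp only [add_apply, sub_apply,
    ContinuousLinearMap.comp_apply, ContinuousLinearMap.flip_apply] at e1 e2
  have e3 := hs u v
  have hc := fderiv_extForm_cyclic hβ (z x) u v
  have hanti : ∀ w a b, fderiv ℝ (extForm β) x w a b = - fderiv ℝ (extForm β) x w b a := by
    intro w a b
    simp only [fderiv_extForm_apply hβ]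
    ring
  have hanti2 : ∀ a b, extForm β x a b = - extForm β x b a := by
    intro a b; simp
  rw [hanti u (z x) v] at e1
  rw [hanti2 u (fderiv ℝ z x v), extForm_apply β x u v]
  linarith

/-- Here `a` and `b` are vectors transported by the linearized flow. By `lieDerivative_extForm`, the
function `e^{-s} dβ(a, b)` has zero derivative along the trajectory. -/
lemma extForm_flow {β : E → E →L[ℝ] ℝ} {z : E → E} {h : E → ℝ} {T : ℝ} {γ a b : ℝ → E}
    (hT : 0 < T)
    (hβ : ∀ t ∈ Set.Ioo (-T) T, ContDiffAt ℝ ∞ β (γ t))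
    (hz : ∀ t ∈ Set.Ioo (-T) T, ContDiffAt ℝ ∞ z (γ t))
    (hh : ∀ t ∈ Set.Ioo (-T) T, ContDiffAt ℝ ∞ h (γ t))
    (H : ∀ t ∈ Set.Ioo (-T) T, ∀ᶠ y in 𝓝 (γ t), extForm β y (z y) = β y - fderiv ℝ h y)
    (hγ : ∀ t ∈ Set.Ioo (-T) T, HasDerivAt γ (z (γ t)) t)
    (ha : ∀ t ∈ Set.Ioo (-T) T, HasDerivAt a (fderiv ℝ z (γ t) (a t)) t)
    (hb : ∀ t ∈ Set.Ioo (-T) T, HasDerivAt b (fderiv ℝ z (γ t) (b t)) t)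
    {t : ℝ} (ht : t ∈ Set.Ioo (-T) T) :
    extForm β (γ t) (a t) (b t) = Real.exp t * extForm β (γ 0) (a 0) (b 0) := by
  set q : ℝ → ℝ := fun s => Real.exp (-s) * extForm β (γ s) (a s) (b s) with hq
  have hd : ∀ s ∈ Set.Ioo (-T) T, HasDerivAt q 0 s := by
    intro s hs
    have hB := ((contDiffAt_extForm (hβ s hs)).differentiableAt (by simp)).hasFDerivAt
    have h1 := ((HasFDerivAt.comp_hasDerivAt s hB (hγ s hs)).clm_apply (ha s hs)).clm_apply
      (hb s hs)
    have h2 := ((hasDerivAt_id s).neg.exp).mul h1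
    refine HasDerivAt.congr_deriv h2 ?_
    have := lieDerivative_extForm (hβ s hs) (hz s hs) (hh s hs) (H s hs) (a s) (b s)
    simp only [Function.comp, add_apply] at this ⊢
    rw [this]
    ring
  have h0 : (0 : ℝ) ∈ Set.Ioo (-T) T := ⟨by linarith, hT⟩
  have heq : q t = q 0 := isOpen_Ioo.is_const_of_deriv_eq_zero isPreconnected_Ioo
    (fun s hs => (hd s hs).differentiableAt.differentiableWithinAt)
    (fun s hs => (hd s hs).deriv) ht h0
  simp only [hq, neg_zero, Real.exp_zero, one_mul] at heq
  rw [← heq, ← mul_assoc, ← Real.exp_add]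
  simp

/-- An integral curve of a field that is tangent to a subspace cannot leave the subspace. -/
lemma eventually_mem_subspace [FiniteDimensional ℝ E] {z : E → E} {W : Submodule ℝ E} {γ : ℝ → E}
    {t₀ : ℝ} (hz : ContDiffAt ℝ 1 z (γ t₀)) (hW : ∀ᶠ y in 𝓝 (γ t₀), y ∈ W → z y ∈ W)
    (hγ : ∀ᶠ t in 𝓝 t₀, HasDerivAt γ (z (γ t)) t) (h0 : γ t₀ ∈ W) : ∀ᶠ t in 𝓝 t₀, γ t ∈ W := by
  obtain ⟨p, hp⟩ := Submodule.ClosedComplemented.of_finiteDimensional W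
  set w₀ : W := ⟨γ t₀, h0⟩ with hw₀
  -- Projecting `z` gives a field on `W` itself. Its integral curve is also one of `z`, because `z`
  -- is tangent to `W` along `W`; uniqueness then identifies it with `γ`.
  have hzW : ContDiffAt ℝ 1 (fun w : W => p (z w)) w₀ :=
    p.contDiff.contDiffAt.comp w₀ (ContDiffAt.comp w₀ (g := z) hz W.subtypeL.contDiff.contDiffAt)
  have : CompleteSpace W := FiniteDimensional.complete ℝ W
  obtain ⟨c, hc0, ε, hε, hc⟩ :=
    hzW.exists_forall_mem_closedBall_exists_eq_forall_mem_Ioo_hasDerivAt₀ t₀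
  have hcW : ∀ᶠ t in 𝓝 t₀, HasDerivAt c (p (z (c t))) t := by
    filter_upwards [Ioo_mem_nhds (by linarith : t₀ - ε < t₀) (by linarith : t₀ < t₀ + ε)] with t ht
      using hc t ht
  have hcc : ContinuousAt (fun t => (c t : E)) t₀ :=
    continuous_subtype_val.continuousAt.comp hcW.self_of_nhds.continuousAt
  have hc1 : (c t₀ : E) = γ t₀ := by rw [hc0]
  rw [ContinuousAt, hc1] at hcc
  have hcE : ∀ᶠ t in 𝓝 t₀, HasDerivAt (fun t => (c t : E)) (z (c t)) t := by
    filter_upwards [hcW, hcc.eventually hW] with t h1 h2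
    have h3 := W.subtypeL.hasFDerivAt.comp_hasDerivAt t h1
    have h4 := hp ⟨z (c t), h2 (c t).2⟩
    simp only at h4
    rw [h4] at h3
    exact h3
  obtain ⟨K, s, hs, hlip⟩ := hz.exists_lipschitzOnWith
  have hγc : ContinuousAt γ t₀ := hγ.self_of_nhds.continuousAt
  have := ODE_solution_unique_of_eventually (v := fun _ => z) (s := fun _ => s) (K := K)
    (Filter.Eventually.of_forall fun _ => hlip) (hγ.and (hγc.eventually hs))
    (hcE.and (hcc.eventually hs)) hc1.symm
  filter_upwards [this] with t ht
  rw [ht]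
  exact (c t).2

end LinearModel

/-! ### Forms and tangent vectors in arbitrary smooth charts -/

section Charts

variable {E : Type*} [NormedAddCommGroup E] [NormedSpace ℝ E]
  {H : Type*} [TopologicalSpace H] {I : ModelWithCorners ℝ E H}
  {M : Type*} [TopologicalSpace M] [ChartedSpace H M]

variable (I) in
/-- A smooth chart with values in the model vector space. -/
structure IsSmoothChart (c : PartialEquiv M E) : Prop where
  open_source : IsOpen c.source
  open_target : IsOpen c.target
  smooth : ContMDiffOn I 𝓘(ℝ, E) ∞ c c.source
  smooth_symm : ContMDiffOn 𝓘(ℝ, E) I ∞ c.symm c.target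

lemma isSmoothChart_extend [IsManifold I ∞ M] [I.Boundaryless] {e : OpenPartialHomeomorph M H}
    (he : e ∈ IsManifold.maximalAtlas I ∞ M) : IsSmoothChart I (e.extend I) where
  open_source := by rw [e.extend_source]; exact e.open_source
  open_target := e.isOpen_extend_target
  smooth := by rw [e.extend_source]; exact e.contMDiffOn_extend he
  smooth_symm := by
    rw [e.extend_target']; exact contMDiffOn_extend_symm he

lemma isSmoothChart_extChartAt [IsManifold I ∞ M] [I.Boundaryless] (p : M) :
    IsSmoothChart I (extChartAt I p) :=
  isSmoothChart_extend (IsManifold.chart_mem_maximalAtlas p)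

variable (I) in
/-- The derivative of a chart, as a linear map to the model vector space. -/
def chartDeriv (c : PartialEquiv M E) (x : M) : TangentSpace I x →L[ℝ] E :=
  mfderiv I 𝓘(ℝ, E) c x

variable (I) in
/-- The derivative of the inverse of a chart. -/
def chartSymmDeriv (c : PartialEquiv M E) (y : E) : E →L[ℝ] TangentSpace I (c.symm y) :=
  mfderiv 𝓘(ℝ, E) I c.symm y

variable (I) in
/-- The expression of a 1-form in a chart. -/
def formIn (c : PartialEquiv M E) (θ : OneForm I M) (y : E) : E →L[ℝ] ℝ :=
  (θ (c.symm y)).comp (chartSymmDeriv I c y)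

namespace IsSmoothChart

variable {c c' : PartialEquiv M E} (hc : IsSmoothChart I c) (hc' : IsSmoothChart I c')
include hc

lemma contMDiffAt {x : M} (hx : x ∈ c.source) : ContMDiffAt I 𝓘(ℝ, E) ∞ c x :=
  hc.smooth.contMDiffAt (hc.open_source.mem_nhds hx)

lemma contMDiffAt_symm {y : E} (hy : y ∈ c.target) : ContMDiffAt 𝓘(ℝ, E) I ∞ c.symm y :=
  hc.smooth_symm.contMDiffAt (hc.open_target.mem_nhds hy)

lemma hasMFDerivAt {x : M} (hx : x ∈ c.source) :
    HasMFDerivAt I 𝓘(ℝ, E) c x (chartDeriv I c x) :=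
  ((hc.contMDiffAt hx).mdifferentiableAt (by simp)).hasMFDerivAt

lemma hasMFDerivAt_symm {y : E} (hy : y ∈ c.target) :
    HasMFDerivAt 𝓘(ℝ, E) I c.symm y (chartSymmDeriv I c y) :=
  ((hc.contMDiffAt_symm hy).mdifferentiableAt (by simp)).hasMFDerivAt

lemma chartDeriv_symm_apply {y : E} (hy : y ∈ c.target) (w : E) :
    chartDeriv I c (c.symm y) (chartSymmDeriv I c y w) = w := by
  have h := (hc.hasMFDerivAt (c.map_target hy)).comp y (hc.hasMFDerivAt_symm hy)
  have h2 : HasMFDerivAt 𝓘(ℝ, E) 𝓘(ℝ, E) (c ∘ c.symm) y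
      (ContinuousLinearMap.id ℝ (TangentSpace 𝓘(ℝ, E) y)) := by
    refine (hasMFDerivAt_id (I := 𝓘(ℝ, E)) y).congr_of_eventuallyEq ?_
    filter_upwards [hc.open_target.mem_nhds hy] with z hz using c.right_inv hz
  have h3 := hasMFDerivAt_unique h h2
  exact DFunLike.congr_fun h3 w

lemma chartSymmDeriv_apply {x : M} (hx : x ∈ c.source) (v : TangentSpace I x) :
    (chartSymmDeriv I c (c x) (chartDeriv I c x v) : E) = v := by
  have hy := c.map_source hx
  have h := (show HasMFDerivAt 𝓘(ℝ, E) I c.symm (c x) (chartSymmDeriv I c (c x)) from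
    hc.hasMFDerivAt_symm hy).comp x (hc.hasMFDerivAt hx)
  have h2 : HasMFDerivAt I I (c.symm ∘ c) x (ContinuousLinearMap.id ℝ (TangentSpace I x)) := by
    refine (hasMFDerivAt_id (I := I) x).congr_of_eventuallyEq ?_
    filter_upwards [hc.open_source.mem_nhds hx] with z hz using c.left_inv hz
  have h3 := hasMFDerivAt_unique h h2
  exact DFunLike.congr_fun h3 v

lemma formIn_chartDeriv (θ : OneForm I M) {x : M} (hx : x ∈ c.source) (v : TangentSpace I x) :
    formIn I c θ (c x) (chartDeriv I c x v) = θ x v := by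
  have h := hc.chartSymmDeriv_apply hx v
  -- The points `c.symm (c x)` and `x` are equal but their tangent spaces are distinct types;
  -- generalizing the base point allows the substitution.
  have h2 : ∀ z : M, z = x → ∀ w : TangentSpace I z, (w : E) = (v : E) → θ z w = θ x v := by
    rintro z rfl w hw
    exact congrArg (θ z) hw
  exact h2 _ (c.left_inv hx) _ h

lemma chartDeriv_injective {x : M} (hx : x ∈ c.source) :
    Function.Injective (chartDeriv I c x) := by
  intro u v huv
  have h1 := hc.chartSymmDeriv_apply hx u
  have h2 := hc.chartSymmDeriv_apply hx v
  rw [huv] at h1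
  exact h1.symm.trans h2

lemma chartDeriv_surjective {x : M} (hx : x ∈ c.source) :
    Function.Surjective (chartDeriv I c x) := by
  intro w
  have h := hc.chartDeriv_symm_apply (c.map_source hx) w
  have h2 : ∀ z : M, z = x → ∀ a : TangentSpace I z, chartDeriv I c z a = w →
      ∃ b : TangentSpace I x, chartDeriv I c x b = w := by
    rintro z rfl a ha
    exact ⟨a, ha⟩
  exact h2 _ (c.left_inv hx) _ h

include hc' in
lemma contDiffAt_trans {y : E} (hy : y ∈ c.target) (hy' : c.symm y ∈ c'.source) :
    ContDiffAt ℝ ∞ (c' ∘ c.symm) y :=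
  contMDiffAt_iff_contDiffAt.1 ((hc'.contMDiffAt hy').comp y (hc.contMDiffAt_symm hy))

include hc' in
lemma fderiv_trans {y : E} (hy : y ∈ c.target) (hy' : c.symm y ∈ c'.source) (w : E) :
    fderiv ℝ (c' ∘ c.symm) y w = chartDeriv I c' (c.symm y) (chartSymmDeriv I c y w) := by
  have h := (hc'.hasMFDerivAt hy').comp y (hc.hasMFDerivAt_symm hy)
  have h2 : @HasFDerivAt ℝ _ E _ _ _ E _ _ _ (c' ∘ c.symm)
      (((chartDeriv I c' (c.symm y)).comp (chartSymmDeriv I c y) : E →L[ℝ] E)) y :=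
    hasMFDerivAt_iff_hasFDerivAt.1 h
  exact DFunLike.congr_fun h2.fderiv w

include hc' in
lemma formIn_trans (θ : OneForm I M) {y : E} (hy : y ∈ c.target) (hy' : c.symm y ∈ c'.source) :
    formIn I c θ y =
      (formIn I c' θ ((c' ∘ c.symm) y)).comp (fderiv ℝ (c' ∘ c.symm) y) := by
  ext w
  rw [ContinuousLinearMap.comp_apply, fderiv_trans hc hc' hy hy']
  exact (hc'.formIn_chartDeriv θ hy' (chartSymmDeriv I c y w)).symm

include hc' in
lemma formIn_trans_eventually (θ : OneForm I M) {y : E} (hy : y ∈ c.target)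
    (hy' : c.symm y ∈ c'.source) : ∀ᶠ z in 𝓝 y, formIn I c θ z =
      (formIn I c' θ ((c' ∘ c.symm) z)).comp (fderiv ℝ (c' ∘ c.symm) z) := by
  filter_upwards [hc.open_target.mem_nhds hy, (hc.contMDiffAt_symm hy).continuousAt
    (hc'.open_source.mem_nhds hy')] with z hz hz' using hc.formIn_trans hc' θ hz hz'

/-- `IsSmooth` speaks only of preferred charts; pulling back along a smooth transition map reaches
every other smooth chart, in particular slice charts of submanifolds. -/
lemma contDiffAt_formIn [IsManifold I ∞ M] [I.Boundaryless] {θ : OneForm I M}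
    (hθ : OneForm.IsSmooth I θ) {y : E} (hy : y ∈ c.target) :
    ContDiffAt ℝ ∞ (formIn I c θ) y := by
  have hc' := isSmoothChart_extChartAt (I := I) (c.symm y)
  have hy' := mem_extChartAt_source (I := I) (c.symm y)
  have h1 := hc.contDiffAt_trans hc' hy hy'
  have h2 : ContDiffAt ℝ ∞ (formIn I (extChartAt I (c.symm y)) θ)
      ((extChartAt I (c.symm y) ∘ c.symm) y) :=
    (hθ (c.symm y)).contDiffAt (hc'.open_target.mem_nhds
      ((extChartAt I (c.symm y)).map_source hy'))
  refine ContDiffAt.congr_of_eventuallyEq ?_ (hc.formIn_trans_eventually hc' θ hy hy')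
  exact (h2.comp y h1).clm_comp (h1.fderiv_right (by simp))

/-- The exterior derivative does not depend on the chart in which it is computed. -/
lemma d_eq [IsManifold I ∞ M] [I.Boundaryless] {θ : OneForm I M}
    (hθ : OneForm.IsSmooth I θ) {x : M} (hx : x ∈ c.source) (u v : TangentSpace I x) :
    OneForm.d I θ x u v =
      extForm (formIn I c θ) (c x) (chartDeriv I c x u) (chartDeriv I c x v) := by
  set c' := extChartAt I x with hcdef
  have hc' : IsSmoothChart I c' := isSmoothChart_extChartAt x
  have hx' : x ∈ c'.source := mem_extChartAt_source x
  have hy' : c'.symm (c' x) ∈ c.source := by rw [c'.left_inv hx']; exact hx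
  have e0 : (c ∘ c'.symm) (c' x) = c x := by simp [c'.left_inv hx']
  have hl : OneForm.d I θ x u v =
      extForm (formIn I c' θ) (c' x) (chartDeriv I c' x u) (chartDeriv I c' x v) := rfl
  have h3 : ∀ w : TangentSpace I x,
      fderiv ℝ (c ∘ c'.symm) (c' x) (chartDeriv I c' x w) = chartDeriv I c x w := by
    intro w
    rw [hc'.fderiv_trans hc (c'.map_source hx') hy']
    have h := hc'.chartSymmDeriv_apply hx' w
    have h2 : ∀ z : M, z = x → ∀ a : TangentSpace I z, (a : E) = (w : E) →
        chartDeriv I c z a = chartDeriv I c x w := by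
      rintro z rfl a ha
      exact congrArg (chartDeriv I c z) ha
    exact h2 _ (c'.left_inv hx') _ h
  have h1 : extForm (formIn I c' θ) (c' x) = extForm (fun z =>
      (formIn I c θ ((c ∘ c'.symm) z)).comp (fderiv ℝ (c ∘ c'.symm) z)) (c' x) := by
    unfold extForm
    rw [Filter.EventuallyEq.fderiv_eq
      (hc'.formIn_trans_eventually hc θ (c'.map_source hx') hy')]
  rw [hl, h1, extForm_pullback (by rw [e0]; exact hc.contDiffAt_formIn hθ (c.map_source hx))
    (hc'.contDiffAt_trans hc (c'.map_source hx') hy'), h3, h3, e0]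

end IsSmoothChart

end Charts

/-! ### The field `Z` with `ι_Z dθ = θ - dh` -/

section LiouvilleField

/-- The differential of a real function on a manifold, as a 1-form. -/
def differential {E : Type*} [NormedAddCommGroup E] [NormedSpace ℝ E] {H : Type*}
    [TopologicalSpace H] (I : ModelWithCorners ℝ E H) {M : Type*} [TopologicalSpace M]
    [ChartedSpace H M] (h : M → ℝ) (x : M) : TangentSpace I x →L[ℝ] ℝ :=
  mfderiv I 𝓘(ℝ, ℝ) h x

lemma isInvertible_of_nondegenerate {E : Type*} [NormedAddCommGroup E] [NormedSpace ℝ E]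
    [FiniteDimensional ℝ E] {B : E →L[ℝ] E →L[ℝ] ℝ} (hB : ∀ u, B u = 0 → u = 0) :
    B.IsInvertible := by
  have hdim : Module.finrank ℝ E = Module.finrank ℝ (E →L[ℝ] ℝ) := by
    rw [← (LinearMap.toContinuousLinearMap (𝕜 := ℝ) (E := E) (F' := ℝ)).finrank_eq]
    exact (Subspace.dual_finrank_eq (K := ℝ) (V := E)).symm
  let e := (LinearMap.linearEquivOfInjective B.toLinearMap
    (LinearMap.ker_eq_bot.1 (LinearMap.ker_eq_bot'.2 hB)) hdim).toContinuousLinearEquiv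
  exact ⟨e, by ext u v; rfl⟩

/-- Multiplication by a bump function. It turns a field known only in a chart into a global one, as
`exists_smooth_local_flow` demands. -/
lemma exists_contDiff_eventuallyEq {E F : Type*} [NormedAddCommGroup E] [NormedSpace ℝ E]
    [FiniteDimensional ℝ E] [NormedAddCommGroup F] [NormedSpace ℝ F] {z : E → F} {Ω : Set E}
    (hΩ : IsOpen Ω) (hz : ∀ y ∈ Ω, ContDiffAt ℝ ∞ z y) {x : E} (hx : x ∈ Ω) :
    ∃ v : E → F, ContDiff ℝ ∞ v ∧ v =ᶠ[𝓝 x] z := by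
  obtain ⟨r, hr, hball⟩ := Metric.isOpen_iff.1 hΩ x hx
  let f : ContDiffBump x := ⟨r / 4, r / 2, by positivity, by linarith⟩
  refine ⟨fun y => f y • z y, ?_, ?_⟩
  · rw [contDiff_iff_contDiffAt]
    intro y
    by_cases hy : y ∈ Metric.ball x r
    · exact f.contDiff.contDiffAt.smul (hz y (hball hy))
    · have h0 : (fun y => f y • z y) =ᶠ[𝓝 y] fun _ => 0 := by
        have hy2 : y ∈ (tsupport f)ᶜ := by
          rw [f.tsupport_eq]
          intro h
          apply hy
          rw [Metric.mem_closedBall] at h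
          rw [Metric.mem_ball]
          have : f.rOut = r / 2 := rfl
          linarith
        filter_upwards [(isClosed_tsupport f).isOpen_compl.mem_nhds hy2] with w hw
        rw [image_eq_zero_of_notMem_tsupport hw, zero_smul]
      exact contDiffAt_const.congr_of_eventuallyEq h0
  · filter_upwards [f.eventuallyEq_one] with y hy
    simp [hy]

variable {E : Type*} [NormedAddCommGroup E] [NormedSpace ℝ E] [FiniteDimensional ℝ E]
  {H : Type*} [TopologicalSpace H] {I : ModelWithCorners ℝ E H} [I.Boundaryless]
  {M : Type*} [TopologicalSpace M] [ChartedSpace H M] [IsManifold I ∞ M]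

variable (I) in
/-- The exterior derivative of `θ` is nondegenerate at every point. -/
def IsNondegenerateForm (θ : OneForm I M) : Prop :=
  ∀ (x : M) (u : TangentSpace I x), (∀ v : TangentSpace I x, OneForm.d I θ x u v = 0) → u = 0

variable (I) in
/-- The equation `ι_Z dθ = θ - dh`. -/
def IsLiouvilleField (θ : OneForm I M) (h : M → ℝ) (Z : (x : M) → TangentSpace I x) : Prop :=
  ∀ (x : M) (v : TangentSpace I x),
    OneForm.d I θ x (Z x) v = θ x v - differential I h x v

variable (I) in
/-- The expression in a chart of the field `Z` with `ι_Z dθ = θ - dh`. -/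
def liouvilleIn (c : PartialEquiv M E) (θ : OneForm I M) (h : M → ℝ) (y : E) : E :=
  (extForm (formIn I c θ) y).inverse (formIn I c θ y - fderiv ℝ (h ∘ c.symm) y)

variable {θ : OneForm I M} (hθ : OneForm.IsSmooth I θ) (hnd : IsNondegenerateForm I θ)
  {h : M → ℝ} (hh : ContMDiff I 𝓘(ℝ, ℝ) ∞ h) {Z : (x : M) → TangentSpace I x}
  (hZ : IsLiouvilleField I θ h Z) {c : PartialEquiv M E} (hc : IsSmoothChart I c)

include hθ hnd hc in
lemma isInvertible_extForm_formIn {y : E} (hy : y ∈ c.target) :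
    (extForm (formIn I c θ) y).IsInvertible := by
  refine isInvertible_of_nondegenerate fun u hu => ?_
  have hx := c.map_target hy
  obtain ⟨u', rfl⟩ := hc.chartDeriv_surjective hx u
  rw [hnd _ u' fun v => ?_, map_zero]
  rw [hc.d_eq hθ hx, c.right_inv hy, hu]
  rfl

include hh hc in
lemma contDiffAt_comp_chart_symm {y : E} (hy : y ∈ c.target) :
    ContDiffAt ℝ ∞ (h ∘ c.symm) y :=
  contMDiffAt_iff_contDiffAt.1 (hh.contMDiffAt.comp y (hc.contMDiffAt_symm hy))

include hθ hnd hh hc in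
lemma contDiffAt_liouvilleIn {y : E} (hy : y ∈ c.target) :
    ContDiffAt ℝ ∞ (liouvilleIn I c θ h) y := by
  have h1 := hc.contDiffAt_formIn hθ hy
  have h2 : ContDiffAt ℝ ∞ (fderiv ℝ (h ∘ c.symm)) y :=
    (contDiffAt_comp_chart_symm hh hc hy).fderiv_right (by simp)
  have h3 := (isInvertible_extForm_formIn hθ hnd hc hy).contDiffAt_map_inverse (n := ∞)
  exact (h3.comp y (contDiffAt_extForm h1)).clm_apply (h1.sub h2)

include hθ hnd hc in
lemma extForm_liouvilleIn {y : E} (hy : y ∈ c.target) :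
    extForm (formIn I c θ) y (liouvilleIn I c θ h y) =
      formIn I c θ y - fderiv ℝ (h ∘ c.symm) y := by
  obtain ⟨e, he⟩ := isInvertible_extForm_formIn hθ hnd hc hy
  rw [liouvilleIn, ← he]
  simp

include hh hc in
lemma fderiv_comp_chart_symm {x : M} (hx : x ∈ c.source) (v : TangentSpace I x) :
    fderiv ℝ (h ∘ c.symm) (c x) (chartDeriv I c x v) = differential I h x v := by
  have h1 := (contDiffAt_comp_chart_symm hh hc (c.map_source hx)).differentiableAt (by simp)
  have h2 := h1.hasFDerivAt.hasMFDerivAt.comp x (hc.hasMFDerivAt hx)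
  have h3 : HasMFDerivAt I 𝓘(ℝ, ℝ) h x _ := h2.congr_of_eventuallyEq (by
    filter_upwards [hc.open_source.mem_nhds hx] with z hz
    simp [c.left_inv hz])
  exact (DFunLike.congr_fun h3.mfderiv v).symm

include hθ hnd hh hc in
-- Nondegeneracy makes the equation at a point uniquely solvable, so the intrinsic solution and the
-- chart expression determine each other. Existence of `Z`, its smoothness and its chart
-- computations all pass through this equivalence.
lemma liouville_eq_iff {x : M} (hx : x ∈ c.source) (w : TangentSpace I x) :
    (∀ v : TangentSpace I x,
      OneForm.d I θ x w v = θ x v - differential I h x v) ↔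
      chartDeriv I c x w = liouvilleIn I c θ h (c x) := by
  have hy := c.map_source hx
  have key := extForm_liouvilleIn (h := h) hθ hnd hc hy
  obtain ⟨e, he⟩ := isInvertible_extForm_formIn hθ hnd hc hy
  have h1 : ∀ v : TangentSpace I x, θ x v - differential I h x v =
      extForm (formIn I c θ) (c x) (liouvilleIn I c θ h (c x)) (chartDeriv I c x v) := by
    intro v
    rw [key, sub_apply, hc.formIn_chartDeriv θ hx,
      fderiv_comp_chart_symm hh hc hx]
  constructor
  · intro H
    have h2 : extForm (formIn I c θ) (c x) (chartDeriv I c x w) =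
        extForm (formIn I c θ) (c x) (liouvilleIn I c θ h (c x)) := by
      ext v
      obtain ⟨v', rfl⟩ := hc.chartDeriv_surjective hx v
      rw [← h1, ← H, hc.d_eq hθ hx]
    rw [← he] at h2
    exact e.injective h2
  · intro H v
    rw [hc.d_eq hθ hx, h1, H]

include hθ hnd hh in
variable (θ h) in
lemma exists_liouvilleField : ∃ Z : (x : M) → TangentSpace I x, IsLiouvilleField I θ h Z := by
  have : ∀ x : M, ∃ w : TangentSpace I x, ∀ v : TangentSpace I x,
      OneForm.d I θ x w v = θ x v - differential I h x v := by
    intro x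
    have hc := isSmoothChart_extChartAt (I := I) x
    have hx := mem_extChartAt_source (I := I) x
    obtain ⟨w, hw⟩ := hc.chartDeriv_surjective hx (liouvilleIn I (extChartAt I x) θ h _)
    exact ⟨w, (liouville_eq_iff hθ hnd hh hc hx w).2 hw⟩
  choose Z hZ using this
  exact ⟨Z, hZ⟩

include hθ hnd hh hZ in
-- Smoothness as a section of the tangent bundle is what uniqueness of integral curves on a manifold
-- requires.
lemma contMDiff_liouvilleField :
    ContMDiff I I.tangent ∞ (fun x => (⟨x, Z x⟩ : TangentBundle I M)) := by
  intro x₀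
  have hc := isSmoothChart_extChartAt (I := I) x₀
  have hx := mem_extChartAt_source (I := I) x₀
  rw [Bundle.contMDiffAt_section]
  have h1 : ContMDiffAt I 𝓘(ℝ, E) ∞
      (liouvilleIn I (extChartAt I x₀) θ h ∘ extChartAt I x₀) x₀ :=
    ((contDiffAt_liouvilleIn hθ hnd hh hc
      ((extChartAt I x₀).map_source hx)).contMDiffAt).comp x₀ (hc.contMDiffAt hx)
  refine h1.congr_of_eventuallyEq ?_
  filter_upwards [hc.open_source.mem_nhds hx] with x hxs
  have h2 := (liouville_eq_iff hθ hnd hh hc hxs (Z x)).1 (hZ x)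
  rw [Function.comp_apply, ← h2]
  rw [extChartAt_source] at hxs
  have h3 := TangentBundle.continuousLinearMapAt_trivializationAt (I := I) hxs
  have h4 := DFunLike.congr_fun h3 (Z x)
  rw [Bundle.Trivialization.continuousLinearMapAt_apply_of_mem] at h4
  · exact h4
  · simpa using hxs

end LiouvilleField

/-! ### Local conformally symplectic flows -/

section FlowBox

variable {E : Type*} [NormedAddCommGroup E] [NormedSpace ℝ E]
  {H : Type*} [TopologicalSpace H] {I : ModelWithCorners ℝ E H}
  {M : Type*} [TopologicalSpace M] [ChartedSpace H M]

variable (I) in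
/-- The map `f` is smooth near `x` and multiplies the 2-form `dθ` at `x` by `k`. -/
structure IsConformalAt (θ : OneForm I M) (k : ℝ) (f : M → M) (x : M) : Prop where
  contMDiffAt : ContMDiffAt I I ∞ f x
  conformal : ∀ u v : TangentSpace I x,
    OneForm.d I θ (f x) (mfderiv I I f x u) (mfderiv I I f x v) = k * OneForm.d I θ x u v

variable (I) in
/-- `φ` is the flow of `Z` on `U` for times in `(-T, T)`; it is smooth and conformally
symplectic for `dθ`. -/
structure IsFlowOn (θ : OneForm I M) (Z : (x : M) → TangentSpace I x) (T : ℝ) (U : Set M)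
    (φ : ℝ → M → M) : Prop where
  zero : ∀ x ∈ U, φ 0 x = x
  curve : ∀ x ∈ U, IsMIntegralCurveOn (fun t => φ t x) Z (Set.Ioo (-T) T)
  conformal : ∀ x ∈ U, ∀ t ∈ Set.Ioo (-T) T, IsConformalAt I θ (Real.exp t) (φ t) x

lemma IsConformalAt.congr {θ : OneForm I M} {k : ℝ} {f g : M → M} {x : M}
    (hf : IsConformalAt I θ k f x) (h : g =ᶠ[𝓝 x] f) : IsConformalAt I θ k g x := by
  have hx := h.self_of_nhds
  refine ⟨hf.contMDiffAt.congr_of_eventuallyEq h, fun u v => ?_⟩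
  have h1 : HasMFDerivAt I I g x (mfderiv I I f x) :=
    ((hf.contMDiffAt.mdifferentiableAt (by simp)).hasMFDerivAt).congr_of_eventuallyEq h
  have key : ∀ (y : M) (A : TangentSpace I x →L[ℝ] TangentSpace I y),
      HasMFDerivAt I I g x A → g x = y →
      OneForm.d I θ (g x) (mfderiv I I g x u) (mfderiv I I g x v) =
        OneForm.d I θ y (A u) (A v) := by
    rintro y A hA rfl
    rw [hA.mfderiv]
  rw [key (f x) (mfderiv I I f x) h1 hx, hf.conformal]

lemma IsConformalAt.comp {θ : OneForm I M} {k l : ℝ} {f g : M → M} {x : M}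
    (hg : IsConformalAt I θ l g (f x)) (hf : IsConformalAt I θ k f x) :
    IsConformalAt I θ (l * k) (g ∘ f) x := by
  refine ⟨hg.contMDiffAt.comp x hf.contMDiffAt, fun u v => ?_⟩
  have h1 := mfderiv_comp x (hg.contMDiffAt.mdifferentiableAt (by simp))
    (hf.contMDiffAt.mdifferentiableAt (by simp))
  rw [h1]
  have h2 := hg.conformal (mfderiv I I f x u) (mfderiv I I f x v)
  rw [hf.conformal] at h2
  rw [mul_assoc]
  exact h2

variable [FiniteDimensional ℝ E] [I.Boundaryless] [IsManifold I ∞ M]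
  {θ : OneForm I M} (hθ : OneForm.IsSmooth I θ) (hnd : IsNondegenerateForm I θ)
  {h : M → ℝ} (hh : ContMDiff I 𝓘(ℝ, ℝ) ∞ h) {Z : (x : M) → TangentSpace I x}
  (hZ : IsLiouvilleField I θ h Z)

include hθ hnd hh hZ in
/-- Around every point, the field `Z` with `ι_Z dθ = θ - dh` has a smooth local flow, and this
flow expands `dθ` exponentially. -/
theorem exists_flowOn (x₀ : M) : ∃ T > (0 : ℝ), ∃ U : Set M, IsOpen U ∧ x₀ ∈ U ∧
    ∃ φ : ℝ → M → M, IsFlowOn I θ Z T U φ := by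
  set c := extChartAt I x₀ with hcdef
  have hc : IsSmoothChart I c := isSmoothChart_extChartAt x₀
  have hx₀ : x₀ ∈ c.source := mem_extChartAt_source x₀
  obtain ⟨v, hv, hvz⟩ := exists_contDiff_eventuallyEq hc.open_target
    (fun y hy => contDiffAt_liouvilleIn hθ hnd hh hc hy) (c.map_source hx₀)
  -- On `Ω` the global extension `v` coincides with the chart expression of `Z`. Trajectories are
  -- kept inside `Ω`, so the flow of `v` is there the flow of `Z`.
  obtain ⟨Ω, hΩsub, hΩo, hxΩ⟩ := mem_nhds_iff.1
    (Filter.inter_mem hvz (hc.open_target.mem_nhds (c.map_source hx₀)))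
  obtain ⟨T, hT, U, hUo, hxU, ψ, hψ, H⟩ := exists_smooth_local_flow v hv (c x₀)
    (hΩo.mem_nhds hxΩ)
  have hΩt : ∀ y ∈ Ω, y ∈ c.target := fun y hy => (hΩsub hy).2
  have hΩv : ∀ y ∈ Ω, v =ᶠ[𝓝 y] liouvilleIn I c θ h := fun y hy => by
    filter_upwards [hΩo.mem_nhds hy] with w hw using (hΩsub hw).1
  refine ⟨T, hT, c.source ∩ c ⁻¹' U, hc.smooth.continuousOn.isOpen_inter_preimage
    hc.open_source hUo, ⟨hx₀, hxU⟩, fun t x => c.symm (ψ t (c x)), ?_, ?_, ?_⟩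
  · rintro x ⟨hx, hxU⟩
    simp only [(H (c x) hxU).1, c.left_inv hx]
  · rintro x ⟨hx, hxU⟩ t ht
    obtain ⟨h1, h2, -⟩ := (H (c x) hxU).2 t ht
    have h3 := (hc.hasMFDerivAt_symm (hΩt _ h1)).comp t h2.hasFDerivAt.hasMFDerivAt
    refine HasMFDerivAt.hasMFDerivWithinAt (h3.congr_mfderiv ?_)
    have h4 := (liouville_eq_iff hθ hnd hh hc (c.map_target (hΩt _ h1)) (Z _)).1 (hZ _)
    have h5 : chartSymmDeriv I c (ψ t (c x)) (v (ψ t (c x))) = Z (c.symm (ψ t (c x))) := by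
      refine hc.chartDeriv_injective (c.map_target (hΩt _ h1)) ?_
      rw [hc.chartDeriv_symm_apply (hΩt _ h1), h4, c.right_inv (hΩt _ h1),
        (hΩv _ h1).self_of_nhds]
    ext
    change chartSymmDeriv I c (ψ t (c x)) ((1 : ℝ) • v (ψ t (c x))) =
      (1 : ℝ) • Z (c.symm (ψ t (c x)))
    rw [one_smul, one_smul, h5]
  · rintro x ⟨hx, hxU⟩ t ht
    obtain ⟨h1, h2, h3⟩ := (H (c x) hxU).2 t ht
    have hψt : ContDiffAt ℝ ∞ (ψ t) (c x) := (hψ t).contDiffAt (hUo.mem_nhds hxU)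
    have hsm : ContMDiffAt I I ∞ (fun x => c.symm (ψ t (c x))) x :=
      (hc.contMDiffAt_symm (hΩt _ h1)).comp x (hψt.contMDiffAt.comp x (hc.contMDiffAt hx))
    refine ⟨hsm, fun a b => ?_⟩
    have hcs := c.map_target (hΩt _ h1)
    have key : ∀ a : TangentSpace I x,
        chartDeriv I c (c.symm (ψ t (c x))) (mfderiv I I (fun x => c.symm (ψ t (c x))) x a) =
          fderiv ℝ (ψ t) (c x) (chartDeriv I c x a) := by
      intro a
      have k1 : HasMFDerivAt I 𝓘(ℝ, E) (c ∘ (fun x => c.symm (ψ t (c x)))) x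
          ((chartDeriv I c (c.symm (ψ t (c x)))).comp
            (mfderiv I I (fun x => c.symm (ψ t (c x))) x)) :=
        (hc.hasMFDerivAt hcs).comp x (hsm.mdifferentiableAt (by simp)).hasMFDerivAt
      have k2 := (hψt.differentiableAt (by simp)).hasFDerivAt.hasMFDerivAt.comp x
        (hc.hasMFDerivAt hx)
      have k3 : (c ∘ (fun x => c.symm (ψ t (c x)))) =ᶠ[𝓝 x] ψ t ∘ c := by
        filter_upwards [(hψt.continuousAt.comp (hc.contMDiffAt hx).continuousAt)
          (hΩo.mem_nhds h1)] with y hy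
        exact c.right_inv (hΩt _ hy)
      exact DFunLike.congr_fun (hasMFDerivAt_unique k1 (k2.congr_of_eventuallyEq k3)) a
    rw [hc.d_eq hθ hcs, key, key, hc.d_eq hθ hx, c.right_inv (hΩt _ h1)]
    have hfl := extForm_flow (β := formIn I c θ) (z := v) (h := h ∘ c.symm)
      (γ := fun s => ψ s (c x)) (a := fun s => fderiv ℝ (ψ s) (c x) (chartDeriv I c x a))
      (b := fun s => fderiv ℝ (ψ s) (c x) (chartDeriv I c x b)) hT
      (fun s hs => hc.contDiffAt_formIn hθ (hΩt _ ((H (c x) hxU).2 s hs).1))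
      (fun s hs => hv.contDiffAt)
      (fun s hs => contDiffAt_comp_chart_symm hh hc (hΩt _ ((H (c x) hxU).2 s hs).1))
      (fun s hs => by
        have := ((H (c x) hxU).2 s hs).1
        filter_upwards [hΩo.mem_nhds this] with y hy
        rw [(hΩsub hy).1]
        exact extForm_liouvilleIn hθ hnd hc (hΩt _ hy))
      (fun s hs => ((H (c x) hxU).2 s hs).2.1)
      (fun s hs => ((H (c x) hxU).2 s hs).2.2 _)
      (fun s hs => ((H (c x) hxU).2 s hs).2.2 _) ht
    have h0 : fderiv ℝ (ψ 0) (c x) = ContinuousLinearMap.id ℝ E := by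
      have : ψ 0 =ᶠ[𝓝 (c x)] id := by
        filter_upwards [hUo.mem_nhds hxU] with y hy using (H y hy).1
      rw [this.fderiv_eq, fderiv_id]
    simp only [h0, (H (c x) hxU).1, ContinuousLinearMap.id_apply] at hfl
    exact hfl

end FlowBox

/-! ### Invariance of a Lagrangian under the flow -/

section LagrangianInvariance

/-- A Lagrangian subspace of a symplectic vector space contains its symplectic complement. -/
lemma mem_of_isotropic {E : Type*} [NormedAddCommGroup E] [NormedSpace ℝ E]
    [FiniteDimensional ℝ E] {B : E →L[ℝ] E →L[ℝ] ℝ} (hB : B.IsInvertible) {W : Submodule ℝ E}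
    (hdim : Module.finrank ℝ E = 2 * Module.finrank ℝ W)
    (hW : ∀ u ∈ W, ∀ w ∈ W, B u w = 0) {z : E} (hz : ∀ w ∈ W, B z w = 0) : z ∈ W := by
  obtain ⟨e, rfl⟩ := hB
  -- The map `u ↦ B(u, ·)|_W` is onto the dual of `W`, so its kernel has the dimension of `W`;
  -- isotropy puts `W` inside the kernel, hence they are equal.
  let f : E →ₗ[ℝ] Module.Dual ℝ W :=
    { toFun := fun u => (e u : E →L[ℝ] ℝ).toLinearMap.comp W.subtype
      map_add' := fun u v => by ext w; simp
      map_smul' := fun r v => by ext w; simp }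
  have hsurj : Function.Surjective f := by
    intro g
    obtain ⟨g', hg'⟩ := LinearMap.exists_extend g
    refine ⟨e.symm (LinearMap.toContinuousLinearMap g'), ?_⟩
    ext w
    have := DFunLike.congr_fun hg' w
    simpa [f] using this
  have h1 := LinearMap.finrank_range_add_finrank_ker f
  rw [LinearMap.range_eq_top.2 hsurj, finrank_top, Subspace.dual_finrank_eq] at h1
  have h2 : W ≤ LinearMap.ker f := by
    intro w hw
    rw [LinearMap.mem_ker]
    ext w'
    exact hW w hw w' w'.2
  have h3 := Submodule.eq_of_le_of_finrank_eq h2 (by omega)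
  rw [h3, LinearMap.mem_ker]
  ext w'
  exact hz w' w'.2

variable {E : Type*} [NormedAddCommGroup E] [NormedSpace ℝ E]
  {H : Type*} [TopologicalSpace H] {I : ModelWithCorners ℝ E H}
  {M : Type*} [TopologicalSpace M] [ChartedSpace H M]

/-- `tangentTo` asks for curves in `L` defined for all time, and a straight line could leave the
chart. The curve `y + δ sin(t/δ) w` has velocity `w` at `0` and stays within `r/2` of `y`. -/
lemma chartSymmDeriv_mem_tangentTo {c : PartialEquiv M E} (hc : IsSmoothChart I c) {L : Set M}
    {W : Submodule ℝ E} (hL : ∀ x ∈ c.source, (x ∈ L ↔ c x ∈ W)) {y : E} (hy : y ∈ c.target)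
    (hyW : y ∈ W) {w : E} (hw : w ∈ W) :
    chartSymmDeriv I c y w ∈ tangentTo I L (c.symm y) := by
  obtain ⟨r, hr, hball⟩ := Metric.isOpen_iff.1 hc.open_target y hy
  set δ : ℝ := r / (2 * (‖w‖ + 1)) with hδ
  have hδ0 : 0 < δ := by positivity
  set σ : ℝ → E := fun t => y + (δ * Real.sin (t / δ)) • w with hσ
  have hσt : ∀ t, σ t ∈ c.target := by
    intro t
    apply hball
    rw [Metric.mem_ball, dist_eq_norm]
    simp only [hσ, add_sub_cancel_left, norm_smul, Real.norm_eq_abs, abs_mul, abs_of_pos hδ0]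
    calc δ * |Real.sin (t / δ)| * ‖w‖ ≤ δ * 1 * ‖w‖ := by
          gcongr; exact Real.abs_sin_le_one _
      _ ≤ δ * 1 * (‖w‖ + 1) := by gcongr; linarith
      _ = r / 2 := by rw [hδ]; field_simp
      _ < r := by linarith
  have hσs : ContDiff ℝ ∞ σ :=
    contDiff_const.add ((contDiff_const.mul
      (Real.contDiff_sin.comp (contDiff_id.div_const δ))).smul contDiff_const)
  have hσ0 : σ 0 = y := by simp [hσ]
  have hσd : HasDerivAt σ w 0 := by
    have h1 : HasDerivAt (fun t : ℝ => Real.sin (t / δ)) (Real.cos (0 / δ) * (1 / δ)) 0 :=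
      (Real.hasDerivAt_sin _).comp (0 : ℝ) ((hasDerivAt_id (0 : ℝ)).div_const δ)
    have h2 := ((h1.const_mul δ).smul_const w).const_add y
    convert! h2 using 1
    rw [zero_div, Real.cos_zero, one_mul, mul_one_div_cancel hδ0.ne', one_smul]
  refine ⟨fun t => c.symm (σ t), fun t => ?_, fun t => ?_, ?_, ?_⟩
  · exact (hc.contMDiffAt_symm (hσt t)).comp t hσs.contMDiff.contMDiffAt
  · rw [hL _ (c.map_target (hσt t)), c.right_inv (hσt t)]
    exact W.add_mem hyW (W.smul_mem _ hw)
  · simp only [hσ0]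
  · have h1 := (show HasMFDerivAt 𝓘(ℝ, E) I c.symm (σ 0) (chartSymmDeriv I c (σ 0)) from
      hc.hasMFDerivAt_symm (hσt 0)).comp 0 hσd.hasFDerivAt.hasMFDerivAt
    have h2 : HasMFDerivAt 𝓘(ℝ, ℝ) I (fun t => c.symm (σ t)) 0 _ := h1
    rw [h2.mfderiv]
    change (chartSymmDeriv I c (σ 0) ((1 : ℝ) • w) : E) = (chartSymmDeriv I c y w : E)
    rw [one_smul, hσ0]

variable [FiniteDimensional ℝ E] [I.Boundaryless] [IsManifold I ∞ M]
  {θ : OneForm I M} (hθ : OneForm.IsSmooth I θ) (hnd : IsNondegenerateForm I θ)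
  {h : M → ℝ} (hh : ContMDiff I 𝓘(ℝ, ℝ) ∞ h) {Z : (x : M) → TangentSpace I x}
  (hZ : IsLiouvilleField I θ h Z)

include hθ hnd hh hZ in
-- For `w` tangent to `L` inside `O`, `dθ(Z, w) = θ(w) - dh(w) = 0`. So `Z` lies in the symplectic
-- complement of the tangent space, which is the tangent space itself, and `eventually_mem_subspace`
-- applies in a slice chart.
lemma eventually_mem_lagrangian {L : Set M} {d : ℕ} (hdim : Module.finrank ℝ E = 2 * d)
    (hL : IsSmoothSubmanifold I d L)
    (hiso : ∀ x ∈ L, ∀ u ∈ tangentTo I L x, ∀ v ∈ tangentTo I L x, OneForm.d I θ x u v = 0)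
    {O : Set M} (hO : IsOpen O)
    (hex : ∀ x ∈ L ∩ O, ∀ v ∈ tangentTo I L x, differential I h x v = θ x v)
    {γ : ℝ → M} {t₀ : ℝ} (hγ : IsMIntegralCurveAt γ Z t₀) (h0 : γ t₀ ∈ L) (h0O : γ t₀ ∈ O) :
    ∀ᶠ t in 𝓝 t₀, γ t ∈ L := by
  obtain ⟨e, he, hxe, W, hWd, hW⟩ := hL _ h0
  set c := e.extend I with hcdef
  have hc : IsSmoothChart I c := isSmoothChart_extend he
  have hsrc : c.source = e.source := e.extend_source
  have hLc : ∀ x ∈ c.source, (x ∈ L ↔ c x ∈ W) := fun x hx => hW x (hsrc ▸ hx)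
  have hx : γ t₀ ∈ c.source := hsrc ▸ hxe
  have hy := c.map_source hx
  have hγc : ContinuousAt γ t₀ := hγ.self_of_nhds.continuousAt
  have htan : ∀ᶠ y in 𝓝 (c (γ t₀)), y ∈ W → liouvilleIn I c θ h y ∈ W := by
    have hOc : ∀ᶠ y in 𝓝 (c (γ t₀)), c.symm y ∈ O :=
      (hc.contMDiffAt_symm hy).continuousAt (by
        rw [c.left_inv hx]; exact hO.mem_nhds h0O)
    filter_upwards [hOc, hc.open_target.mem_nhds hy] with y hyO hyt hyW
    have hyL : c.symm y ∈ L := by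
      rw [hLc _ (c.map_target hyt), c.right_inv hyt]; exact hyW
    refine mem_of_isotropic (isInvertible_extForm_formIn hθ hnd hc hyt) (by rw [hdim, hWd])
      (fun u hu w hw => ?_) (fun w hw => ?_)
    · have h1 := hiso _ hyL _ (chartSymmDeriv_mem_tangentTo hc hLc hyt hyW hu) _
        (chartSymmDeriv_mem_tangentTo hc hLc hyt hyW hw)
      rw [hc.d_eq hθ (c.map_target hyt), hc.chartDeriv_symm_apply hyt,
        hc.chartDeriv_symm_apply hyt, c.right_inv hyt] at h1
      exact h1
    · have h1 := hex _ ⟨hyL, hyO⟩ _ (chartSymmDeriv_mem_tangentTo hc hLc hyt hyW hw)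
      have h2 := fderiv_comp_chart_symm hh hc (c.map_target hyt) (chartSymmDeriv I c y w)
      rw [hc.chartDeriv_symm_apply hyt, c.right_inv hyt] at h2
      rw [extForm_liouvilleIn hθ hnd hc hyt, sub_apply, h2, h1, sub_eq_zero]
      rfl
  have hder : ∀ᶠ t in 𝓝 t₀, HasDerivAt (c ∘ γ) (liouvilleIn I c θ h ((c ∘ γ) t)) t := by
    filter_upwards [hγ, hγc (hc.open_source.mem_nhds hx)] with t ht hts
    have h1 := (hc.hasMFDerivAt hts).comp t ht
    have h2 := hasMFDerivAt_iff_hasFDerivAt.1 h1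
    have h3 := (liouville_eq_iff hθ hnd hh hc hts (Z _)).1 (hZ _)
    rw [hasDerivAt_iff_hasFDerivAt]
    refine h2.congr_fderiv ?_
    ext
    change chartDeriv I c (γ t) ((1 : ℝ) • Z (γ t)) = (1 : ℝ) • liouvilleIn I c θ h (c (γ t))
    rw [one_smul, one_smul, h3]
  have hz1 : ContDiffAt ℝ 1 (liouvilleIn I c θ h) ((c ∘ γ) t₀) :=
    (contDiffAt_liouvilleIn hθ hnd hh hc hy).of_le (by simp)
  have := eventually_mem_subspace hz1 htan hder ((hLc _ hx).1 h0)
  filter_upwards [this, hγc (hc.open_source.mem_nhds hx)] with t ht hts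
  exact (hLc _ hts).2 ht

include hθ hnd hh hZ in
/-- Integral curves of `Z` do not leave a closed Lagrangian submanifold on which `θ = dh`. -/
theorem mem_lagrangian_of_integralCurve {L : Set M} {d : ℕ}
    (hdim : Module.finrank ℝ E = 2 * d) (hLc : IsClosed L) (hL : IsSmoothSubmanifold I d L)
    (hiso : ∀ x ∈ L, ∀ u ∈ tangentTo I L x, ∀ v ∈ tangentTo I L x, OneForm.d I θ x u v = 0)
    {O : Set M} (hO : IsOpen O)
    (hex : ∀ x ∈ L ∩ O, ∀ v ∈ tangentTo I L x, differential I h x v = θ x v)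
    {γ : ℝ → M} {a b : ℝ} (hγ : IsMIntegralCurveOn γ Z (Set.Ioo a b))
    {s t : ℝ} (hs : s ∈ Set.Ioo a b) (ht : t ∈ Set.Ioo a b)
    (hγO : ∀ r ∈ Set.uIcc s t, γ r ∈ O) (hsL : γ s ∈ L) : γ t ∈ L := by
  have hsub : Set.uIcc s t ⊆ Set.Ioo a b := (Set.ordConnected_Ioo).uIcc_subset hs ht
  -- A connectedness argument on the interval between `s` and `t`: `S` is open by construction, and
  -- relatively closed because `L` is closed and the local statement applies at limit times.
  set S : Set ℝ := {r | r ∈ Set.Ioo a b ∧ ∀ᶠ q in 𝓝 r, γ q ∈ L} with hS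
  have hat : ∀ r ∈ Set.Ioo a b, IsMIntegralCurveAt γ Z r := fun r hr =>
    hγ.isMIntegralCurveAt (Ioo_mem_nhds hr.1 hr.2)
  have hSo : IsOpen S := by
    rw [isOpen_iff_mem_nhds]
    rintro r ⟨hr, hr2⟩
    filter_upwards [Ioo_mem_nhds hr.1 hr.2, eventually_eventually_nhds.2 hr2] with q h1 h2
      using ⟨h1, h2⟩
  have hsS : s ∈ S := ⟨hs, eventually_mem_lagrangian hθ hnd hh hZ hdim hL hiso hO hex (hat s hs)
    hsL (hγO s Set.left_mem_uIcc)⟩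
  have := (isPreconnected_uIcc (a := s) (b := t)).subset_of_closure_inter_subset hSo
    ⟨s, Set.left_mem_uIcc, hsS⟩ (by
      rintro r ⟨hr, hr2⟩
      have hrI := hsub hr2
      refine ⟨hrI, eventually_mem_lagrangian hθ hnd hh hZ hdim hL hiso hO hex (hat r hrI) ?_
        (hγO r hr2)⟩
      by_contra hn
      have hcont : ContinuousAt γ r := (hat r hrI).continuousAt
      have h1 := hcont (hLc.isOpen_compl.mem_nhds hn)
      obtain ⟨q, hq1, hq2⟩ := mem_closure_iff_nhds.1 hr _ h1
      exact hq1 hq2.2.self_of_nhds)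
  exact (this Set.right_mem_uIcc).2.self_of_nhds

end LagrangianInvariance

/-! ### From local flows to a flow for uniform time -/

section UniformFlow

variable {E : Type*} [NormedAddCommGroup E] [NormedSpace ℝ E] [FiniteDimensional ℝ E]
  {H : Type*} [TopologicalSpace H] {I : ModelWithCorners ℝ E H} [I.Boundaryless]
  {M : Type*} [TopologicalSpace M] [ChartedSpace H M] [IsManifold I ∞ M] [T2Space M]
  {θ : OneForm I M} (hθ : OneForm.IsSmooth I θ) (hnd : IsNondegenerateForm I θ)
  {h : M → ℝ} (hh : ContMDiff I 𝓘(ℝ, ℝ) ∞ h) {Z : (x : M) → TangentSpace I x}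
  (hZ : IsLiouvilleField I θ h Z)

include hθ hnd hh hZ in
lemma integralCurve_eqOn {γ γ' : ℝ → M} {a b t₀ : ℝ} (ht₀ : t₀ ∈ Set.Ioo a b)
    (hγ : IsMIntegralCurveOn γ Z (Set.Ioo a b)) (hγ' : IsMIntegralCurveOn γ' Z (Set.Ioo a b))
    (h0 : γ t₀ = γ' t₀) : Set.EqOn γ γ' (Set.Ioo a b) :=
  isMIntegralCurveOn_Ioo_eqOn_of_contMDiff_boundaryless ht₀
    ((contMDiff_liouvilleField hθ hnd hh hZ).of_le (by simp)) hγ hγ' h0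

lemma IsFlowOn.mono {T T' : ℝ} {U : Set M} {φ : ℝ → M → M} (hφ : IsFlowOn I θ Z T U φ)
    (hT : T' ≤ T) : IsFlowOn I θ Z T' U φ := by
  have hsub : Set.Ioo (-T') T' ⊆ Set.Ioo (-T) T := Set.Ioo_subset_Ioo (by linarith) hT
  exact ⟨hφ.zero, fun x hx => (hφ.curve x hx).mono hsub,
    fun x hx t ht => hφ.conformal x hx t (hsub ht)⟩

include hθ hnd hh hZ in
/-- If the flow of `Z` exists up to time `1` off a compact set, then it exists everywhere for some
positive time. -/
theorem exists_uniform_flow {K : Set M} (hK : IsCompact K) {F₀ : ℝ → M → M}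
    (hF₀ : IsFlowOn I θ Z 1 Kᶜ F₀) :
    ∃ T > (0 : ℝ), ∃ F : ℝ → M → M, IsFlowOn I θ Z T Set.univ F := by
  choose T hT U hUo hxU φ hφ using exists_flowOn hθ hnd hh hZ
  obtain ⟨s, hs⟩ := hK.elim_finite_subcover U hUo
    (fun x _ => Set.mem_iUnion.2 ⟨x, hxU x⟩)
  obtain ⟨T₀, hT₀, hT₀1, hT₀s⟩ : ∃ T₀ > (0 : ℝ), T₀ ≤ 1 ∧ ∀ x ∈ s, T₀ ≤ T x := by
    classical
    clear hs
    induction s using Finset.induction_on with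
    | empty => exact ⟨1, by norm_num, le_refl _, by simp⟩
    | insert x s _ ih =>
      obtain ⟨T₁, h1, h2, h3⟩ := ih
      refine ⟨min T₁ (T x), lt_min h1 (hT x), (min_le_left _ _).trans h2, fun y hy => ?_⟩
      rcases Finset.mem_insert.1 hy with rfl | hy
      · exact min_le_right _ _
      · exact (min_le_left _ _).trans (h3 y hy)
  have hbox : ∀ x : M, ∃ V : Set M, IsOpen V ∧ x ∈ V ∧ ∃ ψ : ℝ → M → M,
      IsFlowOn I θ Z T₀ V ψ := by
    intro x
    by_cases hx : x ∈ K
    · obtain ⟨y, hy⟩ := Set.mem_iUnion.1 (hs hx)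
      obtain ⟨hys, hxy⟩ := Set.mem_iUnion.1 hy
      exact ⟨U y, hUo y, hxy, φ y, (hφ y).mono (hT₀s y hys)⟩
    · exact ⟨Kᶜ, hK.isClosed.isOpen_compl, hx, F₀, hF₀.mono hT₀1⟩
  choose V hVo hxV ψ hψ using hbox
  have h00 : (0 : ℝ) ∈ Set.Ioo (-T₀) T₀ := ⟨by linarith, hT₀⟩
  -- By uniqueness of integral curves the local flows agree on overlaps. The glued map, which uses
  -- at each point its own box, therefore coincides near `x` with the single smooth map `ψ x t`.
  have heq : ∀ x, ∀ y ∈ V x, ∀ t ∈ Set.Ioo (-T₀) T₀, ψ y t y = ψ x t y := fun x y hy t ht =>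
    integralCurve_eqOn hθ hnd hh hZ h00 ((hψ y).curve y (hxV y)) ((hψ x).curve y hy)
      (by rw [(hψ y).zero y (hxV y), (hψ x).zero y hy]) ht
  refine ⟨T₀, hT₀, fun t x => ψ x t x, fun x _ => (hψ x).zero x (hxV x),
    fun x _ => (hψ x).curve x (hxV x), fun x _ t ht => ?_⟩
  refine ((hψ x).conformal x (hxV x) t ht).congr ?_
  filter_upwards [(hVo x).mem_nhds (hxV x)] with y hy using heq x y hy t ht

end UniformFlow

/-! ### Explicit formulas on the symplectization -/

section SymplectizationForms

/-- The model vector space of the symplectization. -/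
abbrev VecX (m : ℕ) := ℝ × (EuclideanSpace ℝ (Fin (2 * m)) × ℝ)

variable {m : ℕ} {P : Type*} [TopologicalSpace P]
  [ChartedSpace (EuclideanSpace ℝ (Fin (2 * m))) P]

lemma sympPrimitive_apply (lam : OneForm (modelP m) P) (x : ℝ × (P × ℝ)) (v : VecX m) :
    sympPrimitive lam x v = Real.exp x.1 * (v.2.2 - lam x.2.1 v.2.1) := by
  simp only [sympPrimitive, contactForm, mfderiv_snd, mfderiv_fst]
  rfl

section Components

variable (x : ℝ × (P × ℝ))

lemma hasMFDerivAt_level : HasMFDerivAt (modelX m) 𝓘(ℝ, ℝ) (fun x : ℝ × (P × ℝ) => x.1) x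
    (ContinuousLinearMap.fst ℝ ℝ (EuclideanSpace ℝ (Fin (2 * m)) × ℝ)) :=
  hasMFDerivAt_fst x

lemma hasMFDerivAt_base : HasMFDerivAt (modelX m) (modelP m) (fun x : ℝ × (P × ℝ) => x.2.1) x
    ((ContinuousLinearMap.fst ℝ (EuclideanSpace ℝ (Fin (2 * m))) ℝ).comp
      (ContinuousLinearMap.snd ℝ ℝ (EuclideanSpace ℝ (Fin (2 * m)) × ℝ))) :=
  (hasMFDerivAt_fst (I := modelP m) (I' := 𝓘(ℝ, ℝ)) x.2).comp x (hasMFDerivAt_snd x)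

lemma hasMFDerivAt_height : HasMFDerivAt (modelX m) 𝓘(ℝ, ℝ) (fun x : ℝ × (P × ℝ) => x.2.2) x
    ((ContinuousLinearMap.snd ℝ (EuclideanSpace ℝ (Fin (2 * m))) ℝ).comp
      (ContinuousLinearMap.snd ℝ ℝ (EuclideanSpace ℝ (Fin (2 * m)) × ℝ))) :=
  (hasMFDerivAt_snd (I := modelP m) (I' := 𝓘(ℝ, ℝ)) x.2).comp x (hasMFDerivAt_snd x)

end Components

/-- The tangent space at `x` is modelled on `E` by the preferred chart at `x`, whose derivative at
`x` is the identity. -/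
lemma extForm_self {E : Type*} [NormedAddCommGroup E] [NormedSpace ℝ E]
    {H : Type*} [TopologicalSpace H] {I : ModelWithCorners ℝ E H}
    {M : Type*} [TopologicalSpace M] [ChartedSpace H M] [IsManifold I ∞ M]
    (θ : OneForm I M) (x : M) (u v : E) :
    OneForm.d I θ x u v = extForm (OneForm.inChart I θ x) (extChartAt I x x) u v := by
  have h : mfderiv I 𝓘(ℝ, E) (extChartAt I x) x = ContinuousLinearMap.id ℝ _ :=
    mfderiv_extChartAt_self
  simp only [OneForm.d, h]
  rfl

lemma inChart_self {E : Type*} [NormedAddCommGroup E] [NormedSpace ℝ E]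
    {H : Type*} [TopologicalSpace H] {I : ModelWithCorners ℝ E H} [I.Boundaryless]
    {M : Type*} [TopologicalSpace M] [ChartedSpace H M] [IsManifold I ∞ M]
    (θ : OneForm I M) (x : M) (v : E) :
    OneForm.inChart I θ x (extChartAt I x x) v = θ x v := by
  have h : mfderiv I 𝓘(ℝ, E) (extChartAt I x) x = ContinuousLinearMap.id ℝ _ :=
    mfderiv_extChartAt_self
  have h2 := (isSmoothChart_extChartAt (I := I) x).formIn_chartDeriv θ
    (mem_extChartAt_source x) v
  rw [chartDeriv, h] at h2
  exact h2

variable [IsManifold (modelP m) ∞ P]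

lemma extChartAt_symplectization (x : ℝ × (P × ℝ)) :
    extChartAt (modelX m) x =
      (PartialEquiv.refl ℝ).prod ((extChartAt (modelP m) x.2.1).prod (PartialEquiv.refl ℝ)) := by
  simp only [extChartAt_prod, extChartAt_model_space_eq_id]

lemma inChart_sympPrimitive (lam : OneForm (modelP m) P) (x : ℝ × (P × ℝ)) {y : VecX m}
    (hy : y ∈ (extChartAt (modelX m) x).target) :
    OneForm.inChart (modelX m) (sympPrimitive lam) x y =
      Real.exp y.1 • ((ContinuousLinearMap.snd ℝ (EuclideanSpace ℝ (Fin (2 * m))) ℝ).comp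
        (ContinuousLinearMap.snd ℝ ℝ _) -
        (OneForm.inChart (modelP m) lam x.2.1 y.2.1).comp
          ((ContinuousLinearMap.fst ℝ (EuclideanSpace ℝ (Fin (2 * m))) ℝ).comp
            (ContinuousLinearMap.snd ℝ ℝ _))) := by
  set φ := extChartAt (modelP m) x.2.1 with hφ
  have hyP : y.2.1 ∈ φ.target := by
    rw [extChartAt_symplectization] at hy
    exact hy.2.1
  have hsymm : ⇑(extChartAt (modelX m) x).symm = fun y : VecX m => (y.1, (φ.symm y.2.1, y.2.2)) := by
    rw [extChartAt_symplectization]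
    rfl
  have hc : IsSmoothChart (modelP m) φ := isSmoothChart_extChartAt _
  have e1 : HasMFDerivAt 𝓘(ℝ, VecX m) 𝓘(ℝ, ℝ) (fun y : VecX m => y.1) y
      (ContinuousLinearMap.fst ℝ ℝ (EuclideanSpace ℝ (Fin (2 * m)) × ℝ)) :=
    (hasFDerivAt_fst).hasMFDerivAt
  have e2 : HasMFDerivAt 𝓘(ℝ, VecX m) 𝓘(ℝ, EuclideanSpace ℝ (Fin (2 * m)))
      (fun y : VecX m => y.2.1) y
      ((ContinuousLinearMap.fst ℝ (EuclideanSpace ℝ (Fin (2 * m))) ℝ).comp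
        (ContinuousLinearMap.snd ℝ ℝ (EuclideanSpace ℝ (Fin (2 * m)) × ℝ))) :=
    HasFDerivAt.hasMFDerivAt (hasFDerivAt_snd.fst)
  have e3 : HasMFDerivAt 𝓘(ℝ, VecX m) 𝓘(ℝ, ℝ) (fun y : VecX m => y.2.2) y
      ((ContinuousLinearMap.snd ℝ (EuclideanSpace ℝ (Fin (2 * m))) ℝ).comp
        (ContinuousLinearMap.snd ℝ ℝ (EuclideanSpace ℝ (Fin (2 * m)) × ℝ))) :=
    HasFDerivAt.hasMFDerivAt (hasFDerivAt_snd.snd)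
  have e4 := (hc.hasMFDerivAt_symm hyP).comp y e2
  have e5 : HasMFDerivAt 𝓘(ℝ, VecX m) (modelX m)
      (fun y : VecX m => (y.1, (φ.symm y.2.1, y.2.2))) y _ := e1.prodMk (e4.prodMk e3)
  refine ContinuousLinearMap.ext fun v => ?_
  rw [OneForm.inChart, hsymm, e5.mfderiv]
  exact sympPrimitive_apply lam (y.1, (φ.symm y.2.1, y.2.2))
    (v.1, ((chartSymmDeriv (modelP m) φ y.2.1 v.2.1 : EuclideanSpace ℝ (Fin (2 * m))), v.2.2))

lemma isSmooth_sympPrimitive {lam : OneForm (modelP m) P}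
    (hlam : OneForm.IsSmooth (modelP m) lam) :
    OneForm.IsSmooth (modelX m) (sympPrimitive lam) := by
  intro x
  have h1 : ContDiffOn ℝ ∞ (fun y : VecX m => OneForm.inChart (modelP m) lam x.2.1 y.2.1)
      (extChartAt (modelX m) x).target := by
    refine (hlam x.2.1).comp (contDiff_fst.comp contDiff_snd).contDiffOn fun y hy => ?_
    rw [extChartAt_symplectization] at hy
    exact hy.2.1
  refine ContDiffOn.congr ?_ fun y hy => inChart_sympPrimitive lam x hy
  refine (Real.contDiff_exp.comp contDiff_fst).contDiffOn.smul (contDiffOn_const.sub ?_)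
  exact h1.clm_comp contDiffOn_const

/-- The product rule and `dα = -dλ` give `ω = e^s (ds ∧ α - dλ)`. -/
lemma d_sympPrimitive_apply {lam : OneForm (modelP m) P} (hlam : OneForm.IsSmooth (modelP m) lam)
    (x : ℝ × (P × ℝ)) (u v : VecX m) :
    OneForm.d (modelX m) (sympPrimitive lam) x u v = Real.exp x.1 * (u.1 * (v.2.2 - lam x.2.1 v.2.1) -
      v.1 * (u.2.2 - lam x.2.1 u.2.1) - OneForm.d (modelP m) lam x.2.1 u.2.1 v.2.1) := by
  rw [extForm_self, extForm_self]
  set β := OneForm.inChart (modelP m) lam x.2.1 with hβ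
  set φ := extChartAt (modelP m) x.2.1 with hφ
  set y : VecX m := extChartAt (modelX m) x x with hy
  have hyx : y = (x.1, (φ x.2.1, x.2.2)) := by
    rw [hy, extChartAt_symplectization]; rfl
  have hev : OneForm.inChart (modelX m) (sympPrimitive lam) x =ᶠ[𝓝 y] fun y : VecX m =>
      Real.exp y.1 • ((ContinuousLinearMap.snd ℝ (EuclideanSpace ℝ (Fin (2 * m))) ℝ).comp
        (ContinuousLinearMap.snd ℝ ℝ _) -
        (β y.2.1).comp ((ContinuousLinearMap.fst ℝ (EuclideanSpace ℝ (Fin (2 * m))) ℝ).comp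
            (ContinuousLinearMap.snd ℝ ℝ _))) := by
    filter_upwards [extChartAt_target_mem_nhds (I := modelX m) x] with z hz
      using inChart_sympPrimitive lam x hz
  have hβd : HasFDerivAt β (fderiv ℝ β y.2.1) y.2.1 := by
    refine (((hlam x.2.1).contDiffAt ?_).differentiableAt (by simp)).hasFDerivAt
    rw [hyx]
    exact extChartAt_target_mem_nhds (I := modelP m) x.2.1
  have e1 : HasFDerivAt (fun y : VecX m => Real.exp y.1)
      (Real.exp y.1 • ContinuousLinearMap.fst ℝ ℝ (EuclideanSpace ℝ (Fin (2 * m)) × ℝ)) y :=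
    (hasFDerivAt_fst).exp
  have e2 : HasFDerivAt (fun y : VecX m => y.2.1)
      ((ContinuousLinearMap.fst ℝ (EuclideanSpace ℝ (Fin (2 * m))) ℝ).comp
        (ContinuousLinearMap.snd ℝ ℝ (EuclideanSpace ℝ (Fin (2 * m)) × ℝ))) y :=
    hasFDerivAt_snd.fst
  have e3 := (HasFDerivAt.comp (g := β) y hβd e2).clm_comp
    (hasFDerivAt_const ((ContinuousLinearMap.fst ℝ (EuclideanSpace ℝ (Fin (2 * m))) ℝ).comp
            (ContinuousLinearMap.snd ℝ ℝ (EuclideanSpace ℝ (Fin (2 * m)) × ℝ))) y)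
  have e4 := e1.smul (e3.const_sub ((ContinuousLinearMap.snd ℝ (EuclideanSpace ℝ (Fin (2 * m)))
    ℝ).comp (ContinuousLinearMap.snd ℝ ℝ (EuclideanSpace ℝ (Fin (2 * m)) × ℝ))))
  have e5 := (e4.congr_of_eventuallyEq hev).fderiv
  have hself : ∀ w, β (φ x.2.1) w = lam x.2.1 w := fun w => inChart_self lam x.2.1 w
  rw [extForm_apply, extForm_apply, e5, hyx]
  simp only [add_apply, smul_apply, neg_apply,
    ContinuousLinearMap.comp_apply, sub_apply, ContinuousLinearMap.smulRight_apply,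
    ContinuousLinearMap.coe_fst', ContinuousLinearMap.coe_snd', smul_eq_mul, Function.comp,
    ContinuousLinearMap.compL_apply, ContinuousLinearMap.flip_apply, zero_apply, hself]
  simp
  ring

lemma isNondegenerate_sympPrimitive {lam : OneForm (modelP m) P} (hlam : IsLiouvilleForm lam) :
    IsNondegenerateForm (modelX m) (sympPrimitive lam) := by
  intro x u hu
  have key : ∀ v : VecX m, (u : VecX m).1 * (v.2.2 - lam x.2.1 v.2.1) -
      v.1 * ((u : VecX m).2.2 - lam x.2.1 (u : VecX m).2.1) -
      OneForm.d (modelP m) lam x.2.1 (u : VecX m).2.1 v.2.1 = 0 := by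
    intro v
    have h1 := d_sympPrimitive_apply hlam.smooth x u v
    rw [hu v] at h1
    exact (mul_eq_zero.1 h1.symm).resolve_left (Real.exp_pos _).ne'
  have hd0 : ∀ a : EuclideanSpace ℝ (Fin (2 * m)),
      OneForm.d (modelP m) lam x.2.1 a (0 : EuclideanSpace ℝ (Fin (2 * m))) = 0 := by
    intro a; rw [extForm_self]; simp
  have hl0 : lam x.2.1 (0 : EuclideanSpace ℝ (Fin (2 * m))) = 0 := map_zero _
  -- Pairing with `∂_z` isolates the `s`-component. Vectors of `P` then give the `P`-component by
  -- nondegeneracy of `dλ`, and `∂_s` gives the `z`-component.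
  have h1 : (u : VecX m).1 = 0 := by
    have := key (0, (0, 1))
    simpa [hd0, hl0] using this
  have h2 : (u : VecX m).2.1 = 0 := by
    refine hlam.nondegenerate x.2.1 _ fun v => ?_
    have := key (0, (v, 0))
    rw [h1] at this
    simpa using this
  have h3 : (u : VecX m).2.2 = 0 := by
    have := key (1, (0, 0))
    rw [h1, h2] at this
    simpa [hd0, hl0] using this
  exact Prod.ext h1 (Prod.ext h2 h3)

/-- The map `(s, p, z) ↦ (s + c, p, z + G(s))`. -/
def shiftShear (P : Type*) (c : ℝ) (G : ℝ → ℝ) (x : ℝ × (P × ℝ)) : ℝ × (P × ℝ) :=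
  (x.1 + c, (x.2.1, x.2.2 + G x.1))

lemma hasMFDerivAt_shiftShear (c : ℝ) {G : ℝ → ℝ} {g : ℝ} {x : ℝ × (P × ℝ)}
    (hG : HasDerivAt G g x.1) : ∃ A : VecX m →L[ℝ] VecX m,
      HasMFDerivAt (modelX m) (modelX m) (shiftShear P c G) x A ∧
      ∀ v : VecX m, A v = (v.1, (v.2.1, v.2.2 + v.1 * g)) := by
  have e1 : HasMFDerivAt 𝓘(ℝ, ℝ) 𝓘(ℝ, ℝ) (fun s : ℝ => s + c) x.1 _ :=
    ((hasDerivAt_id x.1).add_const c).hasFDerivAt.hasMFDerivAt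
  have e2 := e1.comp x (hasMFDerivAt_level (m := m) x)
  have e3 := hG.hasFDerivAt.hasMFDerivAt.comp x (hasMFDerivAt_level (m := m) x)
  have e4 := (hasMFDerivAt_height (m := m) x).add e3
  refine ⟨_, e2.prodMk ((hasMFDerivAt_base (m := m) x).prodMk e4), fun v => ?_⟩
  refine Prod.ext ?_ (Prod.ext rfl rfl)
  exact mul_one v.1

lemma contMDiff_shiftShear (c : ℝ) {G : ℝ → ℝ} (hG : ContDiff ℝ ∞ G) :
    ContMDiff (modelX m) (modelX m) ∞ (shiftShear P c G) := by
  have h1 : ContMDiff (modelX m) 𝓘(ℝ, ℝ) ∞ (fun x : ℝ × (P × ℝ) => x.1) := contMDiff_fst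
  have h2 : ContMDiff (modelX m) (modelP m) ∞ (fun x : ℝ × (P × ℝ) => x.2.1) :=
    contMDiff_fst.comp contMDiff_snd
  have h3 : ContMDiff (modelX m) 𝓘(ℝ, ℝ) ∞ (fun x : ℝ × (P × ℝ) => x.2.2) :=
    contMDiff_snd.comp contMDiff_snd
  exact (h1.add contMDiff_const).prodMk (h2.prodMk (h3.add (hG.contMDiff.comp h1)))

/-- The shear changes `α` by a multiple of `ds`, which `ds ∧ α` does not see; the translation
contributes the factor `e^c`. -/
lemma isConformalAt_shiftShear {lam : OneForm (modelP m) P}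
    (hlam : OneForm.IsSmooth (modelP m) lam) (c : ℝ) {G : ℝ → ℝ} (hG : ContDiff ℝ ∞ G)
    (x : ℝ × (P × ℝ)) :
    IsConformalAt (modelX m) (sympPrimitive lam) (Real.exp c) (shiftShear P c G) x := by
  obtain ⟨A, hA, hAv⟩ := hasMFDerivAt_shiftShear (m := m) c
    ((hG.differentiable (by simp)) x.1).hasDerivAt
  have key : ∀ u v : VecX m,
      OneForm.d (modelX m) (sympPrimitive lam) (shiftShear P c G x) (A u) (A v) =
        Real.exp c * OneForm.d (modelX m) (sympPrimitive lam) x u v := by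
    intro u v
    rw [d_sympPrimitive_apply hlam, d_sympPrimitive_apply hlam, hAv, hAv]
    have alg : ∀ s c a b p q g k l D : ℝ,
        Real.exp (s + c) * (a * (p + b * g - k) - b * (q + a * g - l) - D) =
          Real.exp c * (Real.exp s * (a * (p - k) - b * (q - l) - D)) := by
      intros
      rw [Real.exp_add]
      ring
    exact alg x.1 c u.1 v.1 v.2.2 u.2.2 (deriv G x.1) (lam x.2.1 v.2.1) (lam x.2.1 u.2.1) _
  refine ⟨(contMDiff_shiftShear c hG).contMDiffAt, fun u v => ?_⟩
  rw [hA.mfderiv]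
  exact key u v

end SymplectizationForms

/-! ### Transport of relative balls and the scaling law -/

section WidthTransfer

variable {m : ℕ} {P : Type*} [TopologicalSpace P]
  [ChartedSpace (EuclideanSpace ℝ (Fin (2 * m))) P] {lam : OneForm (modelP m) P}

lemma smul_mem_closedBall_iff {N : ℕ} {μ r : ℝ} (hμ : 0 < μ) (w : StdSpace N) :
    μ • w ∈ Metric.closedBall (0 : StdSpace N) r ↔ w ∈ Metric.closedBall (0 : StdSpace N) (r / μ) := by
  rw [mem_closedBall_zero_iff, mem_closedBall_zero_iff, norm_smul, Real.norm_of_nonneg hμ.le,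
    le_div_iff₀ hμ, mul_comm]

/-- Composing a relative embedding with a conformally symplectic map and a dilation of the ball. -/
lemma IsRelSymplecticEmbedding.transfer {b b' : EReal} {L L' : Set (ℝ × (P × ℝ))} {r k μ : ℝ}
    {ψ : StdSpace (m + 1) → ℝ × (P × ℝ)} (hψ : IsRelSymplecticEmbedding lam ⊥ b L r ψ)
    (hr : 0 < r) (hμ : 0 < μ) (hk : k * μ ^ 2 = 1) {Ψ : ℝ × (P × ℝ) → ℝ × (P × ℝ)}
    (hΨ : ∀ x, IsConformalAt (modelX m) (sympPrimitive lam) k Ψ x) (hinj : Function.Injective Ψ)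
    (hslab : ∀ w ∈ Metric.closedBall (0 : StdSpace (m + 1)) r, Ψ (ψ w) ∈ slab P ⊥ b')
    (hL : ∀ w ∈ Metric.closedBall (0 : StdSpace (m + 1)) r, (Ψ (ψ w) ∈ L' ↔ ψ w ∈ L)) :
    IsRelSymplecticEmbedding lam ⊥ b' L' (r / μ) (fun w => Ψ (ψ (μ • w))) := by
  have hball : ∀ w ∈ Metric.closedBall (0 : StdSpace (m + 1)) (r / μ),
      μ • w ∈ Metric.closedBall (0 : StdSpace (m + 1)) r :=
    fun w hw => (smul_mem_closedBall_iff hμ w).2 hw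
  have hr' : 0 < r / μ := by positivity
  refine ⟨?_, ?_, ?_, ?_, ?_⟩
  · intro w hw
    have h1 : ContMDiffWithinAt 𝓘(ℝ, StdSpace (m + 1)) (modelX m) ∞ (fun w => ψ (μ • w))
        (Metric.closedBall 0 (r / μ)) w := by
      refine (hψ.smooth _ (hball w hw)).comp w ?_ hball
      exact (contDiff_const_smul μ).contMDiff.contMDiffAt.contMDiffWithinAt
    exact (hΨ _).contMDiffAt.comp_contMDiffWithinAt w h1
  · intro w hw w' hw' h
    have h1 := hψ.injOn (hball w hw) (hball w' hw') (hinj h)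
    exact smul_right_injective _ hμ.ne' h1
  · intro w hw
    exact hslab _ (hball w hw)
  · intro w hw u v
    -- Derivatives within the closed ball are unique because it is convex with nonempty interior;
    -- this makes the chain rule determine `mfderivWithin`.
    have hU : UniqueMDiffWithinAt 𝓘(ℝ, StdSpace (m + 1))
        (Metric.closedBall (0 : StdSpace (m + 1)) (r / μ)) w := by
      rw [uniqueMDiffWithinAt_iff_uniqueDiffWithinAt]
      refine uniqueDiffOn_convex (convex_closedBall _ _) ?_ w hw
      exact ⟨0, Metric.ball_subset_interior_closedBall (Metric.mem_ball_self hr')⟩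
    have h1 := ((hψ.smooth _ (hball w hw)).mdifferentiableWithinAt (by simp)).hasMFDerivWithinAt
    have h2 : HasMFDerivWithinAt 𝓘(ℝ, StdSpace (m + 1)) 𝓘(ℝ, StdSpace (m + 1))
        (fun w : StdSpace (m + 1) => μ • w) (Metric.closedBall 0 (r / μ)) w
        (μ • ContinuousLinearMap.id ℝ (StdSpace (m + 1))) :=
      ((hasFDerivAt_id w).const_smul μ).hasMFDerivAt.hasMFDerivWithinAt
    have h3 := h1.comp w h2 hball
    have h4 := ((hΨ (ψ (μ • w))).contMDiffAt.mdifferentiableAt (by simp)).hasMFDerivAt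
    have h5 := HasMFDerivAt.comp_hasMFDerivWithinAt (g := Ψ) w h4 h3
    have h6 : HasMFDerivWithinAt 𝓘(ℝ, StdSpace (m + 1)) (modelX m) (fun w => Ψ (ψ (μ • w)))
      (Metric.closedBall 0 (r / μ)) w _ := h5
    rw [h6.mfderivWithin hU]
    have h7 := (hΨ (ψ (μ • w))).conformal
      (mfderivWithin 𝓘(ℝ, StdSpace (m + 1)) (modelX m) ψ (Metric.closedBall 0 r) (μ • w) (μ • u))
      (mfderivWithin 𝓘(ℝ, StdSpace (m + 1)) (modelX m) ψ (Metric.closedBall 0 r) (μ • w) (μ • v))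
    have h8 := hψ.symplectic _ (hball w hw) (μ • u) (μ • v)
    unfold sympForm at h8
    rw [h8] at h7
    refine h7.trans ?_
    have h9 : stdForm (μ • u) (μ • v) = μ ^ 2 * stdForm u v := by
      simp only [stdForm, Finset.mul_sum, PiLp.smul_apply, smul_eq_mul]
      refine Finset.sum_congr rfl fun i _ => ?_
      ring
    rw [h9, ← mul_assoc, hk, one_mul]
  · ext w
    simp only [Set.mem_inter_iff, Set.mem_preimage]
    refine and_congr_right fun hw => ?_
    have h1 := Set.ext_iff.1 hψ.relative (μ • w)
    simp only [Set.mem_inter_iff, Set.mem_preimage, hball w hw, true_and,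
      hψ.mapsTo (hball w hw), and_true] at h1
    rw [hL _ (hball w hw), h1]
    simp only [hslab _ (hball w hw), and_true, realPlane, Set.mem_ofPred_eq, PiLp.smul_apply,
      smul_eq_mul, mul_eq_zero, hμ.ne', false_or]

lemma relWidth_le_of_transfer {b b' : EReal} {L L' : Set (ℝ × (P × ℝ))} {μ : ℝ} (hμ : 0 < μ)
    (H : ∀ r > 0, ∀ ψ, IsRelSymplecticEmbedding lam ⊥ b L r ψ →
      ∃ ψ', IsRelSymplecticEmbedding lam ⊥ b' L' (r / μ) ψ') :
    relWidth lam ⊥ b L ≤ ENNReal.ofReal (μ ^ 2) * relWidth lam ⊥ b' L' := by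
  refine sSup_le ?_
  rintro _ ⟨r, hr, ⟨ψ, hψ⟩, rfl⟩
  have h1 : ENNReal.ofReal (Real.pi * (r / μ) ^ 2) ≤ relWidth lam ⊥ b' L' :=
    le_sSup ⟨r / μ, by positivity, H r hr ψ hψ, rfl⟩
  calc ENNReal.ofReal (Real.pi * r ^ 2)
      = ENNReal.ofReal (μ ^ 2) * ENNReal.ofReal (Real.pi * (r / μ) ^ 2) := by
        rw [← ENNReal.ofReal_mul (by positivity)]
        congr 1
        field_simp
    _ ≤ _ := by gcongr

variable [IsManifold (modelP m) ∞ P]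

/-- Translation by `c - b` preserves the cylinder and multiplies `ω` by `e^{c-b}`. Dilating the ball
by `μ = e^{(b-c)/2}` compensates, since `e^{c-b} μ² = 1`. -/
lemma relWidth_cyl_shift_le (hlam : OneForm.IsSmooth (modelP m) lam) (Lam : Set (P × ℝ))
    (b c : ℝ) : relWidth lam ⊥ (b : EReal) (cyl Lam) ≤
      ENNReal.ofReal (Real.exp (b - c)) * relWidth lam ⊥ (c : EReal) (cyl Lam) := by
  have hsq : Real.exp ((b - c) / 2) ^ 2 = Real.exp (b - c) := by
    rw [← Real.exp_nat_mul]; congr 1; push_cast; ring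
  rw [← hsq]
  refine relWidth_le_of_transfer (Real.exp_pos _) fun r hr ψ hψ => ?_
  refine ⟨_, hψ.transfer (k := Real.exp (c - b)) (Ψ := shiftShear P (c - b) (fun _ => 0)) hr
    (Real.exp_pos _) ?_ (isConformalAt_shiftShear hlam (c - b) contDiff_const) ?_ ?_ ?_⟩
  · rw [hsq, ← Real.exp_add]; simp
  · intro x y hxy
    simp only [shiftShear, add_zero, Prod.mk.injEq, add_left_inj] at hxy
    exact Prod.ext hxy.1 (Prod.ext hxy.2.1 hxy.2.2)
  · intro w hw
    have h1 := (hψ.mapsTo hw).2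
    refine ⟨EReal.bot_lt_coe _, ?_⟩
    rw [EReal.coe_lt_coe_iff] at h1 ⊢
    simp only [shiftShear]
    linarith
  · intro w _
    simp [cyl, shiftShear]

/-- The scaling law for cylinders. -/
theorem relWidth_cyl_eq (hlam : OneForm.IsSmooth (modelP m) lam) (Lam : Set (P × ℝ)) (b : ℝ) :
    relWidth lam ⊥ (b : EReal) (cyl Lam) =
      ENNReal.ofReal (Real.exp b) * relWidth lam ⊥ 0 (cyl Lam) := by
  have h1 := relWidth_cyl_shift_le hlam Lam b 0
  have h2 := relWidth_cyl_shift_le hlam Lam 0 b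
  rw [EReal.coe_zero] at h1 h2
  rw [sub_zero] at h1
  refine le_antisymm h1 ?_
  calc _ ≤ ENNReal.ofReal (Real.exp b) * (ENNReal.ofReal (Real.exp (0 - b)) *
        relWidth lam ⊥ (b : EReal) (cyl Lam)) := by gcongr
    _ = relWidth lam ⊥ (b : EReal) (cyl Lam) := by
        rw [← mul_assoc, ← ENNReal.ofReal_mul (Real.exp_pos _).le, ← Real.exp_add]
        simp

end WidthTransfer

/-! ### Primitives on cylinders over Legendrians -/

section PrimitiveConstant

variable {m : ℕ} {P : Type*} [TopologicalSpace P]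
  [ChartedSpace (EuclideanSpace ℝ (Fin (2 * m))) P] {lam : OneForm (modelP m) P}

/-- A velocity vector of a curve in `S` is tangent to `S`, at every time. -/
lemma velocity_mem_tangentTo {E : Type*} [NormedAddCommGroup E] [NormedSpace ℝ E]
    {H : Type*} [TopologicalSpace H] {I : ModelWithCorners ℝ E H}
    {M : Type*} [TopologicalSpace M] [ChartedSpace H M] {S : Set M} {γ : ℝ → M}
    (hγ : ContMDiff 𝓘(ℝ, ℝ) I ∞ γ) (hS : ∀ t, γ t ∈ S) (t : ℝ) :
    mfderiv 𝓘(ℝ, ℝ) I γ t (1 : ℝ) ∈ tangentTo I S (γ t) := by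
  have hs : ContMDiff 𝓘(ℝ, ℝ) 𝓘(ℝ, ℝ) ∞ (fun s : ℝ => t + s) :=
    (contDiff_const.add contDiff_id).contMDiff
  refine ⟨fun s => γ (t + s), hγ.comp hs, fun s => hS _, by simp, ?_⟩
  have h1 : HasMFDerivAt 𝓘(ℝ, ℝ) 𝓘(ℝ, ℝ) (fun s : ℝ => t + s) 0
      (ContinuousLinearMap.toSpanSingleton ℝ (1 : ℝ)) :=
    ((hasDerivAt_id (0 : ℝ)).const_add t).hasFDerivAt.hasMFDerivAt
  have h2 := ((hγ.mdifferentiableAt (by simp) : MDifferentiableAt 𝓘(ℝ, ℝ) I γ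
    (t + 0))).hasMFDerivAt.comp 0 h1
  have h3 : HasMFDerivAt 𝓘(ℝ, ℝ) I (fun s => γ (t + s)) 0 _ := h2
  rw [h3.mfderiv]
  change (mfderiv 𝓘(ℝ, ℝ) I γ (t + 0) ((1 : ℝ) • (1 : ℝ)) : E) = _
  rw [one_smul, add_zero]

lemma IsPrimitiveOn.eq_of_curve {L : Set (ℝ × (P × ℝ))} {f : ℝ × (P × ℝ) → ℝ}
    (hf : IsPrimitiveOn lam L f) {σ : ℝ → ℝ × (P × ℝ)}
    (hσ : ContMDiff 𝓘(ℝ, ℝ) (modelX m) ∞ σ) (hL : ∀ t, σ t ∈ L)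
    (h0 : ∀ t, sympPrimitive lam (σ t) (mfderiv 𝓘(ℝ, ℝ) (modelX m) σ t (1 : ℝ)) = 0) (s t : ℝ) :
    f (σ s) = f (σ t) := by
  have hd : ∀ t, HasDerivAt (f ∘ σ) 0 t := by
    intro t
    have h1 := ((hf.smooth.mdifferentiableAt (by simp) : MDifferentiableAt (modelX m) 𝓘(ℝ, ℝ) f
      (σ t))).hasMFDerivAt.comp t (hσ.mdifferentiableAt (by simp)).hasMFDerivAt
    have h2 := hasMFDerivAt_iff_hasFDerivAt.1 h1
    have h3 := hf.deriv_eq _ (hL t) _ (velocity_mem_tangentTo hσ hL t)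
    rw [h0] at h3
    rw [hasDerivAt_iff_hasFDerivAt]
    refine h2.congr_fderiv ?_
    ext
    change (mfderiv (modelX m) 𝓘(ℝ, ℝ) f (σ t) (mfderiv 𝓘(ℝ, ℝ) (modelX m) σ t (1 : ℝ)) : ℝ) =
      (1 : ℝ) • (0 : ℝ)
    rw [h3, smul_zero]
  exact is_const_of_deriv_eq_zero (fun t => (hd t).differentiableAt) (fun t => (hd t).deriv) s t

variable [IsManifold (modelP m) ∞ P]

/-- The form `e^s α` vanishes on `∂_s`. A smooth transition function provides a path from `s` to
`s'` that is defined for all time and stays in `[a, b]`. -/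
lemma primitive_vertical {L : Set (ℝ × (P × ℝ))} {f : ℝ × (P × ℝ) → ℝ}
    (hf : IsPrimitiveOn lam L f) {a b : ℝ} {q : P × ℝ} (hL : ∀ s ∈ Set.Icc a b, (s, q) ∈ L)
    {s s' : ℝ} (hs : s ∈ Set.Icc a b) (hs' : s' ∈ Set.Icc a b) : f (s, q) = f (s', q) := by
  set g : ℝ → ℝ := fun t => s + Real.smoothTransition t * (s' - s) with hg
  have hgs : ContDiff ℝ ∞ g := contDiff_const.add (Real.smoothTransition.contDiff.mul contDiff_const)
  have hgm : ∀ t, g t ∈ Set.Icc a b := by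
    intro t
    have h1 := Real.smoothTransition.nonneg t
    have h2 := Real.smoothTransition.le_one t
    constructor
    · have : g t = (1 - Real.smoothTransition t) * s + Real.smoothTransition t * s' := by
        simp only [hg]; ring
      rw [this]; nlinarith [hs.1, hs'.1]
    · have : g t = (1 - Real.smoothTransition t) * s + Real.smoothTransition t * s' := by
        simp only [hg]; ring
      rw [this]; nlinarith [hs.2, hs'.2]
  have hσ : ContMDiff 𝓘(ℝ, ℝ) (modelX m) ∞ (fun t => (g t, q)) :=
    hgs.contMDiff.prodMk contMDiff_const
  have key := hf.eq_of_curve hσ (fun t => hL _ (hgm t)) (fun t => by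
    have h1 : HasMFDerivAt 𝓘(ℝ, ℝ) 𝓘(ℝ, ℝ) g t _ :=
      ((hgs.differentiable (by simp)) t).hasFDerivAt.hasMFDerivAt
    have h2 := h1.prodMk (hasMFDerivAt_const (I := 𝓘(ℝ, ℝ)) (I' := modelC m) q t)
    rw [h2.mfderiv]
    refine (sympPrimitive_apply lam (g t, q) (fderiv ℝ g t 1, (0, 0))).trans ?_
    have h3 : lam q.1 (0 : EuclideanSpace ℝ (Fin (2 * m))) = 0 := map_zero _
    change Real.exp (g t) * (0 - lam q.1 (0 : EuclideanSpace ℝ (Fin (2 * m)))) = 0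
    rw [h3, sub_zero, mul_zero]) 0 1
  simpa [hg] using key

/-- In a slice chart nearby points of the Legendrian are joined by a segment inside the slice. The
form `α` vanishes along the resulting curve, so `f` does not change. -/
lemma primitive_horizontal {L : Set (ℝ × (P × ℝ))} {f : ℝ × (P × ℝ) → ℝ}
    (hf : IsPrimitiveOn lam L f) {Lam : Set (P × ℝ)} (hLam : IsClosedLegendrian lam Lam)
    {s : ℝ} (hL : ∀ q ∈ Lam, (s, q) ∈ L) {q₀ : P × ℝ} (hq₀ : q₀ ∈ Lam) :
    ∀ᶠ q in 𝓝 q₀, q ∈ Lam → f (s, q) = f (s, q₀) := by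
  obtain ⟨e, he, hxe, W, -, hW⟩ := hLam.submanifold q₀ hq₀
  set c := e.extend (modelC m) with hcdef
  have hc : IsSmoothChart (modelC m) c := isSmoothChart_extend he
  have hsrc : c.source = e.source := e.extend_source
  have hLc : ∀ x ∈ c.source, (x ∈ Lam ↔ c x ∈ W) := fun x hx => hW x (hsrc ▸ hx)
  have hx : q₀ ∈ c.source := hsrc ▸ hxe
  obtain ⟨r, hr, hball⟩ := Metric.isOpen_iff.1 hc.open_target _ (c.map_source hx)
  filter_upwards [hc.open_source.mem_nhds hx, (hc.contMDiffAt hx).continuousAt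
    (Metric.ball_mem_nhds _ hr)] with q hq hqr hqL
  set β : ℝ → EuclideanSpace ℝ (Fin (2 * m)) × ℝ :=
    fun t => c q₀ + Real.smoothTransition t • (c q - c q₀) with hβ
  have hβs : ContDiff ℝ ∞ β :=
    contDiff_const.add (Real.smoothTransition.contDiff.smul contDiff_const)
  have hβt : ∀ t, β t ∈ c.target := by
    intro t
    apply hball
    rw [Metric.mem_ball, dist_eq_norm] at *
    simp only [hβ, add_sub_cancel_left, norm_smul,
      Real.norm_of_nonneg (Real.smoothTransition.nonneg t)]
    exact (mul_le_of_le_one_left (norm_nonneg _) (Real.smoothTransition.le_one t)).trans_lt hqr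
  have hβL : ∀ t, c.symm (β t) ∈ Lam := by
    intro t
    rw [hLc _ (c.map_target (hβt t)), c.right_inv (hβt t)]
    exact W.add_mem ((hLc _ hx).1 hq₀)
      (W.smul_mem _ (W.sub_mem ((hLc _ hq).1 hqL) ((hLc _ hx).1 hq₀)))
  have hτ : ContMDiff 𝓘(ℝ, ℝ) (modelC m) ∞ (fun t => c.symm (β t)) := fun t =>
    (hc.contMDiffAt_symm (hβt t)).comp t hβs.contMDiff.contMDiffAt
  have hσ : ContMDiff 𝓘(ℝ, ℝ) (modelX m) ∞ (fun t => (s, c.symm (β t))) :=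
    contMDiff_const.prodMk hτ
  have key := hf.eq_of_curve hσ (fun t => hL _ (hβL t)) (fun t => by
    have h1 := ((hτ.mdifferentiableAt (by simp) : MDifferentiableAt 𝓘(ℝ, ℝ) (modelC m)
      (fun t => c.symm (β t)) t)).hasMFDerivAt
    have h2 := (hasMFDerivAt_const (I := 𝓘(ℝ, ℝ)) (I' := 𝓘(ℝ, ℝ)) s t).prodMk h1
    have h3 := hLam.tangent _ (hβL t) _ (velocity_mem_tangentTo hτ hβL t)
    rw [h2.mfderiv]
    simp only [sympPrimitive, mfderiv_snd]
    change Real.exp s * contactForm lam (c.symm (β t))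
      (mfderiv 𝓘(ℝ, ℝ) (modelC m) (fun t => c.symm (β t)) t (1 : ℝ)) = 0
    rw [h3, mul_zero]) 1 0
  simpa [hβ, c.left_inv hx, c.left_inv hq] using key

/-- On a cylinder over a connected Legendrian, every primitive is constant. -/
theorem exists_primitive_eq_const {L : Set (ℝ × (P × ℝ))} {f : ℝ × (P × ℝ) → ℝ}
    (hf : IsPrimitiveOn lam L f) {Lam : Set (P × ℝ)} (hLam : IsClosedLegendrian lam Lam)
    {a b : ℝ} (hab : a < b) (hcyl : L ∩ (Set.Icc a b ×ˢ Set.univ) = Set.Icc a b ×ˢ Lam)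
    (hconn : IsPreconnected Lam) : ∃ C, ∀ x ∈ L, x.1 ∈ Set.Icc a b → f x = C := by
  have hmem : ∀ s ∈ Set.Icc a b, ∀ q ∈ Lam, (s, q) ∈ L := fun s hs q hq =>
    (hcyl.symm.subset (show ((s, q) : ℝ × (P × ℝ)) ∈ Set.Icc a b ×ˢ Lam from ⟨hs, hq⟩)).1
  have hmem' : ∀ x ∈ L, x.1 ∈ Set.Icc a b → x.2 ∈ Lam := fun x hx hs =>
    (hcyl.subset ⟨hx, hs, trivial⟩).2
  have ha : a ∈ Set.Icc a b := ⟨le_refl _, hab.le⟩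
  rcases Lam.eq_empty_or_nonempty with he | ⟨q₀, hq₀⟩
  · exact ⟨0, fun x hx hs => absurd (hmem' x hx hs) (by simp [he])⟩
  have hlc : IsLocallyConstant (fun q : Lam => f (a, (q : P × ℝ))) := by
    rw [IsLocallyConstant.iff_eventually_eq]
    intro q
    have h1 := primitive_horizontal hf hLam (hmem a ha) q.2
    have h2 := (continuous_subtype_val.tendsto q).eventually h1
    filter_upwards [h2] with q' hq' using hq' q'.2
  have : PreconnectedSpace Lam := Subtype.preconnectedSpace hconn
  refine ⟨f (a, q₀), fun x hx hs => ?_⟩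
  have hxq := hmem' x hx hs
  have h1 := primitive_vertical hf (fun s hs => hmem s hs x.2 hxq) hs ha
  exact h1.trans (hlc.apply_eq_of_preconnectedSpace ⟨x.2, hxq⟩ ⟨q₀, hq₀⟩)

end PrimitiveConstant

/-! ### Extending the primitive to a Hamiltonian -/

section CutOff

variable {m : ℕ} {P : Type*} [TopologicalSpace P] [T2Space P] [SecondCountableTopology P]
  [ChartedSpace (EuclideanSpace ℝ (Fin (2 * m))) P] [IsManifold (modelP m) ∞ P]
  {lam : OneForm (modelP m) P}

lemma exists_smooth_cutoff {K₀ V : Set (ℝ × (P × ℝ))} (hK₀ : IsCompact K₀) (hV : IsOpen V)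
    (hKV : K₀ ⊆ V) : ∃ η : ℝ × (P × ℝ) → ℝ, ContMDiff (modelX m) 𝓘(ℝ, ℝ) ∞ η ∧
      (∀ x ∈ K₀, η x = 1) ∧ ∃ K : Set (ℝ × (P × ℝ)), IsCompact K ∧ K ⊆ V ∧ ∀ x ∉ K, η x = 0 := by
  have : LocallyCompactSpace P :=
    ChartedSpace.locallyCompactSpace (EuclideanSpace ℝ (Fin (2 * m))) P
  obtain ⟨K, hK, hKi, hKsub⟩ := exists_compact_between hK₀ hV hKV
  obtain ⟨η, h1, h2, -⟩ := exists_contMDiffMap_one_nhds_of_subset_interior (n := ⊤) (modelX m)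
    hK₀.isClosed hKi
  exact ⟨η, η.contMDiff, fun x hx => h1.self_of_nhdsSet x hx, K, hK, hKsub, h2⟩

/-- A primitive of the Liouville form on `L` extends to a Hamiltonian which off a compact set only
depends on the level, and which is constant above the cylindrical piece. -/
lemma exists_hamiltonian {L : Set (ℝ × (P × ℝ))} {f : ℝ × (P × ℝ) → ℝ} {C a b s₀ : ℝ}
    (hf : ContMDiff (modelX m) 𝓘(ℝ, ℝ) ∞ f) (hab : a < b) (hs₀ : s₀ ≤ a)
    (hC : ∀ x ∈ L, x.1 ∈ Set.Icc a b → f x = C) (h0 : ∀ x ∈ L, x.1 < s₀ → f x = 0)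
    (hcl : IsClosed L) (hcpt : IsCompact (L ∩ {x | x.1 ∈ Set.Icc s₀ b})) :
    ∃ a' ∈ Set.Ioo a b, ∃ h : ℝ × (P × ℝ) → ℝ, ContMDiff (modelX m) 𝓘(ℝ, ℝ) ∞ h ∧
      (∀ x ∈ L, x.1 < b → h x = f x) ∧ ∃ k : ℝ → ℝ, ContDiff ℝ ∞ k ∧
      (∀ x, a' < x.1 → h =ᶠ[𝓝 x] fun _ => C) ∧ ∃ K : Set (ℝ × (P × ℝ)), IsCompact K ∧
      ∀ x ∉ K, h =ᶠ[𝓝 x] fun x => k x.1 := by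
  -- The level function `κ` rises from `0` to `1` over `[a, a₁]`, while the support of the cutoff
  -- `η` ends below `a₂`.
  set a₁ := a + (b - a) / 3 with ha₁
  set a₂ := a + 2 * (b - a) / 3 with ha₂
  have ha1 : a < a₁ := by rw [ha₁]; linarith
  have h12 : a₁ < a₂ := by rw [ha₁, ha₂]; linarith
  have h2b : a₂ < b := by rw [ha₂]; linarith
  set κ : ℝ → ℝ := fun s => Real.smoothTransition ((s - a) / (a₁ - a)) with hκ
  have hκs : ContDiff ℝ ∞ κ :=
    Real.smoothTransition.contDiff.comp ((contDiff_id.sub contDiff_const).div_const _)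
  have hκ0 : ∀ s ≤ a, κ s = 0 := fun s hs =>
    Real.smoothTransition.zero_of_nonpos (div_nonpos_of_nonpos_of_nonneg (by linarith)
      (by linarith))
  have hκ1 : ∀ s, a₁ ≤ s → κ s = 1 := fun s hs =>
    Real.smoothTransition.one_of_one_le ((one_le_div (by linarith)).2 (by linarith))
  have hK₀ : IsCompact (L ∩ {x | x.1 ∈ Set.Icc s₀ a₁}) := by
    refine hcpt.of_isClosed_subset (hcl.inter (isClosed_Icc.preimage continuous_fst)) ?_
    rintro x ⟨hx, hs⟩
    exact ⟨hx, hs.1, hs.2.trans (by linarith)⟩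
  obtain ⟨η, hη, hη1, K, hK, hKV, hη0⟩ := exists_smooth_cutoff (m := m) hK₀
    (isOpen_Iio.preimage continuous_fst : IsOpen {x : ℝ × (P × ℝ) | x.1 ∈ Set.Iio a₂})
    (fun x hx => lt_of_le_of_lt hx.2.2 h12)
  have hκx : ContMDiff (modelX m) 𝓘(ℝ, ℝ) ∞ (fun x : ℝ × (P × ℝ) => C * κ x.1) :=
    contMDiff_const.mul (hκs.contMDiff.comp contMDiff_fst)
  -- The function is `η (f - Cκ) + Cκ`. On `L` it equals `f` in three ranges: below `s₀` both `f`
  -- and `κ` vanish, so `η` need not be `1` on the noncompact end; from `s₀` to `a₁` one has `η =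
  -- 1`; from `a₁` to `b` one has `f = C = Cκ`.
  refine ⟨a₂, ⟨by linarith, h2b⟩, fun x => η x * (f x - C * κ x.1) + C * κ x.1,
    (hη.mul (hf.sub hκx)).add hκx, ?_, fun s => C * κ s, contDiff_const.mul hκs, ?_, K, hK, ?_⟩
  · intro x hx hxb
    change η x * (f x - C * κ x.1) + C * κ x.1 = f x
    rcases lt_or_ge x.1 s₀ with h | h
    · rw [h0 x hx h, hκ0 _ (by linarith)]; ring
    · rcases le_or_gt x.1 a₁ with h' | h'
      · rw [hη1 x ⟨hx, h, h'⟩]; ring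
      · rw [hκ1 _ h'.le, hC x hx ⟨by linarith, hxb.le⟩]; ring
  · intro x hx
    filter_upwards [(isOpen_lt continuous_const continuous_fst).mem_nhds hx] with y hy
    have hyK : y ∉ K := fun h => absurd (hKV h : y.1 < a₂) (not_lt.2 (le_of_lt hy))
    rw [hη0 y hyK, hκ1 y.1 (h12.trans hy).le]; ring
  · intro x hx
    filter_upwards [hK.isClosed.isOpen_compl.mem_nhds hx] with y hy
    rw [hη0 y hy]; ring

end CutOff

/-! ### The flow of `Z` where the Hamiltonian depends on the level alone -/

section OneStep

variable {m : ℕ} {P : Type*} [TopologicalSpace P] [T2Space P]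
  [ChartedSpace (EuclideanSpace ℝ (Fin (2 * m))) P] [IsManifold (modelP m) ∞ P]
  {lam : OneForm (modelP m) P} (hlam : IsLiouvilleForm lam)
  {h : ℝ × (P × ℝ) → ℝ} (hh : ContMDiff (modelX m) 𝓘(ℝ, ℝ) ∞ h)
  {Z : (x : ℝ × (P × ℝ)) → TangentSpace (modelX m) x}
  (hZ : IsLiouvilleField (modelX m) (sympPrimitive lam) h Z)

include hlam hh hZ in
-- For `h = 0` the solution is `∂_s`. Since `ι_{∂_z} ω = -e^s ds`, adding `k'(s) e^{-s} ∂_z`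
-- contributes exactly `-dh`.
lemma liouvilleField_of_level {k : ℝ → ℝ} (hk : Differentiable ℝ k) {x : ℝ × (P × ℝ)}
    (hx : h =ᶠ[𝓝 x] fun x => k x.1) :
    Z x = ((1, (0, deriv k x.1 * Real.exp (-x.1))) : VecX m) := by
  have hθ := isSmooth_sympPrimitive hlam.smooth
  have hnd := isNondegenerate_sympPrimitive hlam
  have hc := isSmoothChart_extChartAt (I := modelX m) x
  have hxs := mem_extChartAt_source (I := modelX m) x
  refine hc.chartDeriv_injective hxs ?_
  rw [(liouville_eq_iff hθ hnd hh hc hxs (Z x)).1 (hZ x)]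
  refine ((liouville_eq_iff hθ hnd hh hc hxs _).1 fun v => ?_).symm
  have h1 : HasMFDerivAt (modelX m) 𝓘(ℝ, ℝ) (fun x : ℝ × (P × ℝ) => k x.1) x _ :=
    (hk x.1).hasDerivAt.hasFDerivAt.hasMFDerivAt.comp x (hasMFDerivAt_level (m := m) x)
  have h2 : ∀ v : VecX m, differential (modelX m) h x v = v.1 * deriv k x.1 := by
    intro v
    rw [differential, (h1.congr_of_eventuallyEq hx).mfderiv]
    rfl
  have h3 : ∀ v : EuclideanSpace ℝ (Fin (2 * m)),
      OneForm.d (modelP m) lam x.2.1 (0 : EuclideanSpace ℝ (Fin (2 * m))) v = 0 := by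
    intro v; rw [extForm_self]; simp
  have h4 : lam x.2.1 (0 : EuclideanSpace ℝ (Fin (2 * m))) = 0 := map_zero _
  refine (d_sympPrimitive_apply hlam.smooth x _ v).trans ?_
  refine Eq.trans ?_ (congrArg₂ (· - ·) (sympPrimitive_apply lam x v) (h2 v)).symm
  have h5 : Real.exp x.1 * Real.exp (-x.1) = 1 := by rw [← Real.exp_add]; simp
  have alg : ∀ e e' d p l v1 A B : ℝ, e * e' = 1 → A = 0 → B = 0 →
      e * (1 * (p - l) - v1 * (d * e' - A) - B) = e * (p - l) - v1 * d := by
    intro e e' d p l v1 A B h hA hB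
    rw [hA, hB]
    linear_combination (-v1 * d) * h
  exact alg _ _ _ _ _ _ _ _ h5 h4 (h3 _)

lemma exists_contDiff_antideriv {g : ℝ → ℝ} (hg : ContDiff ℝ ∞ g) :
    ∃ G : ℝ → ℝ, ContDiff ℝ ∞ G ∧ ∀ s, HasDerivAt G (g s) s := by
  have hd : ∀ s, HasDerivAt (fun s => ∫ r in (0 : ℝ)..s, g r) (g s) s := fun s =>
    (hg.continuous.integral_hasStrictDerivAt 0 s).hasDerivAt
  refine ⟨_, ?_, hd⟩
  rw [contDiff_infty_iff_deriv]
  refine ⟨fun s => (hd s).differentiableAt, ?_⟩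
  rwa [show deriv (fun s => ∫ r in (0 : ℝ)..s, g r) = g from funext fun s => (hd s).deriv]

include hlam hh hZ in
-- Where `h = k(s)` the field depends on `s` only. Its integral curves have unit speed in `s`, fixed
-- base point in `P`, and height given by the antiderivative `G`.
lemma hasMFDerivAt_shear_curve {k G : ℝ → ℝ} (hk : Differentiable ℝ k)
    (hG : ∀ s, HasDerivAt G (deriv k s * Real.exp (-s)) s) {s t r : ℝ} {q : P × ℝ}
    (hx : h =ᶠ[𝓝 (s + t, (q.1, r + G (s + t)))] fun x => k x.1) :
    HasMFDerivAt 𝓘(ℝ, ℝ) (modelX m) (fun t => (s + t, (q.1, r + G (s + t)))) t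
      ((1 : ℝ →L[ℝ] ℝ).smulRight (Z (s + t, (q.1, r + G (s + t))))) := by
  have h1 : HasMFDerivAt 𝓘(ℝ, ℝ) 𝓘(ℝ, ℝ) (fun t : ℝ => s + t) t _ :=
    ((hasDerivAt_id t).const_add s).hasFDerivAt.hasMFDerivAt
  have h2 : HasDerivAt (fun t => r + G (s + t)) (deriv k (s + t) * Real.exp (-(s + t))) t :=
    ((hG (s + t)).comp_const_add s t).const_add r
  have h3 := h1.prodMk ((hasMFDerivAt_const (I := 𝓘(ℝ, ℝ)) (I' := modelP m) q.1 t).prodMk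
    h2.hasFDerivAt.hasMFDerivAt)
  refine h3.congr_mfderiv ?_
  have h4 := liouvilleField_of_level hlam hh hZ hk hx
  refine ContinuousLinearMap.ext fun c => ?_
  have h5 : ∀ (c : ℝ) (w w' : VecX m), w = w' → c • w = c • w' := fun c w w' h => by rw [h]
  refine Eq.trans ?_ (h5 c _ _ h4.symm)
  refine Prod.ext rfl (Prod.ext ?_ rfl)
  exact (smul_zero (M := ℝ) (A := EuclideanSpace ℝ (Fin (2 * m))) c).symm

include hlam hh hZ in
/-- The flow of `Z` exists for a uniform time. -/
lemma exists_symplectization_flow {k : ℝ → ℝ} (hk : ContDiff ℝ ∞ k) {K : Set (ℝ × (P × ℝ))}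
    (hK : IsCompact K) (hkK : ∀ x ∉ K, h =ᶠ[𝓝 x] fun x => k x.1) :
    ∃ T > (0 : ℝ), ∃ F : ℝ → ℝ × (P × ℝ) → ℝ × (P × ℝ),
      IsFlowOn (modelX m) (sympPrimitive lam) Z T Set.univ F := by
  have hθ := isSmooth_sympPrimitive hlam.smooth
  have hnd := isNondegenerate_sympPrimitive hlam
  have hk1 : ContDiff ℝ ∞ (deriv k) := (contDiff_infty_iff_deriv.1 hk).2
  obtain ⟨G, hGs, hG⟩ := exists_contDiff_antideriv
    (hk1.mul (Real.contDiff_exp.comp contDiff_id.neg) :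
      ContDiff ℝ ∞ (fun s => deriv k s * Real.exp (-s)))
  set F₀ : ℝ → ℝ × (P × ℝ) → ℝ × (P × ℝ) :=
    fun t => shiftShear P t (fun s => G (s + t) - G s) with hF₀
  have hinv : ∀ t x, F₀ (-t) (F₀ t x) = x := by
    intro t x
    refine Prod.ext ?_ (Prod.ext rfl ?_)
    · simp only [hF₀, shiftShear, add_neg_cancel_right]
    · simp only [hF₀, shiftShear, add_neg_cancel_right]; ring
  have hcont : Continuous (fun p : ℝ × (ℝ × (P × ℝ)) => F₀ p.1 p.2) := by
    have := hGs.continuous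
    simp only [hF₀, shiftShear]
    fun_prop
  -- `K₁` is what the shears sweep out of `K` for `|t| ≤ 1`. A point outside it cannot reach `K` in
  -- that time, so its shear curve is a true integral curve of `Z`.
  set K₁ := (fun p : ℝ × (ℝ × (P × ℝ)) => F₀ p.1 p.2) '' (Set.Icc (-1 : ℝ) 1 ×ˢ K) with hK₁
  have hK₁c : IsCompact K₁ := (isCompact_Icc.prod hK).image hcont
  refine exists_uniform_flow hθ hnd hh hZ hK₁c (F₀ := F₀) ⟨?_, ?_, ?_⟩
  · intro x _
    simp [hF₀, shiftShear]
  · intro x hx t ht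
    have hFK : F₀ t x ∉ K := by
      intro hmem
      exact hx ⟨(-t, F₀ t x), ⟨⟨by linarith [ht.2], by linarith [ht.1]⟩, hmem⟩, hinv t x⟩
    have heq : ∀ t, F₀ t x = (x.1 + t, (x.2.1, (x.2.2 - G x.1) + G (x.1 + t))) := by
      intro t
      simp only [hF₀, shiftShear]
      congr 2
      ring
    have h1 := hkK _ hFK
    rw [heq] at h1
    have h2 := hasMFDerivAt_shear_curve hlam hh hZ (q := (x.2.1, x.2.2)) (hk.differentiable (by simp)) hG h1
    have h3 : (fun t => F₀ t x) = fun t => (x.1 + t, (x.2.1, (x.2.2 - G x.1) + G (x.1 + t))) :=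
      funext heq
    have h4 : ∀ (g : ℝ → ℝ × (P × ℝ)), g = (fun t => F₀ t x) →
        HasMFDerivAt 𝓘(ℝ, ℝ) (modelX m) g t ((1 : ℝ →L[ℝ] ℝ).smulRight (Z (g t))) →
        HasMFDerivAt 𝓘(ℝ, ℝ) (modelX m) (fun t => F₀ t x) t
          ((1 : ℝ →L[ℝ] ℝ).smulRight (Z (F₀ t x))) := by
      rintro g rfl hg; exact hg
    exact (h4 _ h3.symm h2).hasMFDerivWithinAt
  · intro x _ t _
    exact isConformalAt_shiftShear hlam.smooth t
      ((hGs.comp (contDiff_id.add contDiff_const)).sub hGs) x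

include hlam hh hZ in
/-- In the region where `Z = ∂_s`, integral curves of `Z` are vertical. -/
lemma integralCurve_eq_vertical {a' α β r t : ℝ} (h1 : ∀ x : ℝ × (P × ℝ), a' < x.1 →
      ∃ c : ℝ, h =ᶠ[𝓝 x] fun _ => c) {γ : ℝ → ℝ × (P × ℝ)}
    (hγ : IsMIntegralCurveOn γ Z (Set.Ioo α β)) (hr : r ∈ Set.Ioo α β) (ht : t ∈ Set.Ioo α β)
    (hlow : a' ≤ (γ r).1 + (α - r)) : γ t = ((γ r).1 + (t - r), (γ r).2) := by
  have hθ := isSmooth_sympPrimitive hlam.smooth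
  have hnd := isNondegenerate_sympPrimitive hlam
  -- The vertical candidate must be integral on the whole interval; `hlow` keeps it above `a'` down
  -- to the left end `α`.
  have hσ : IsMIntegralCurveOn (fun t => (((γ r).1 - r) + t, ((γ r).2.1, (γ r).2.2 + 0))) Z
      (Set.Ioo α β) := by
    intro q hq
    obtain ⟨c, hc⟩ := h1 ((γ r).1 - r + q, ((γ r).2.1, (γ r).2.2 + 0)) (by
      simp only; linarith [hq.1])
    exact (hasMFDerivAt_shear_curve hlam hh hZ (k := fun _ => c) (G := fun _ => 0) (q := (γ r).2)
      (differentiable_const c) (fun s => by simpa using hasDerivAt_const s (0 : ℝ))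
      hc).hasMFDerivWithinAt
  have h2 := integralCurve_eqOn hθ hnd hh hZ hr hγ hσ (by
    refine Prod.ext ?_ (Prod.ext rfl ?_) <;> simp) ht
  rw [h2]
  refine Prod.ext ?_ (Prod.ext rfl ?_)
  · simp only; ring
  · simp

end OneStep

/-! ### One symplectic slide along `L` -/

section SlideStep

variable {m : ℕ} {P : Type*} [TopologicalSpace P] [T2Space P]
  [ChartedSpace (EuclideanSpace ℝ (Fin (2 * m))) P] [IsManifold (modelP m) ∞ P]
  {lam : OneForm (modelP m) P}

lemma finrank_vecX (m : ℕ) : Module.finrank ℝ (VecX m) = 2 * (m + 1) := by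
  change Module.finrank ℝ (ℝ × (EuclideanSpace ℝ (Fin (2 * m)) × ℝ)) = 2 * (m + 1)
  rw [Module.finrank_prod, Module.finrank_prod, finrank_euclideanSpace]
  simp only [Module.finrank_self, Fintype.card_fin]
  ring

/-- A Hamiltonian that agrees with a primitive on the part of `L` below `b` is a primitive there. -/
lemma differential_eq_of_eqOn {L : Set (ℝ × (P × ℝ))} {f h : ℝ × (P × ℝ) → ℝ} {b : ℝ}
    (hf : IsPrimitiveOn lam L f) (hh : ContMDiff (modelX m) 𝓘(ℝ, ℝ) ∞ h)
    (hfh : ∀ x ∈ L, x.1 < b → h x = f x) {x : ℝ × (P × ℝ)} (hx : x ∈ L) (hxb : x.1 < b)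
    {v : TangentSpace (modelX m) x} (hv : v ∈ tangentTo (modelX m) L x) :
    differential (modelX m) h x v = sympPrimitive lam x v := by
  refine Eq.trans ?_ (hf.deriv_eq x hx v hv)
  obtain ⟨γ, hγ, hγL, rfl, hv⟩ := hv
  have hγ0 : HasMFDerivAt 𝓘(ℝ, ℝ) (modelX m) γ 0 (mfderiv 𝓘(ℝ, ℝ) (modelX m) γ 0) :=
    (hγ.mdifferentiableAt (by simp)).hasMFDerivAt
  have h1 := ((hh.mdifferentiableAt (by simp) :
    MDifferentiableAt (modelX m) 𝓘(ℝ, ℝ) h (γ 0)).hasMFDerivAt).comp 0 hγ0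
  have h2 := ((hf.smooth.mdifferentiableAt (by simp) :
    MDifferentiableAt (modelX m) 𝓘(ℝ, ℝ) f (γ 0)).hasMFDerivAt).comp 0 hγ0
  -- The functions agree on `L` only, so their differentials are compared along a curve in `L`
  -- representing `v`.
  have h3 : h ∘ γ =ᶠ[𝓝 0] f ∘ γ := by
    have hc : Continuous fun t => (γ t).1 := continuous_fst.comp hγ.continuous
    filter_upwards [(isOpen_lt hc continuous_const).mem_nhds hxb] with t ht
    exact hfh _ (hγL t) ht
  have h4 : (mfderiv 𝓘(ℝ, ℝ) (modelX m) γ 0 (1 : ℝ)) = v := hv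
  rw [← h4]
  have h5 := h1.mfderiv
  rw [h3.mfderiv_eq, h2.mfderiv] at h5
  exact (DFunLike.congr_fun h5 (1 : ℝ)).symm

/-- A small slide: an injective symplectic map of the symplectization, supported below the
cylindrical piece over `[a, b]`, which carries a translate of `L` to `L`. -/
theorem exists_slide [SecondCountableTopology P] (hlam : IsLiouvilleForm lam)
    {L : Set (ℝ × (P × ℝ))} (hL : IsLagrangian lam L)
    {f : ℝ × (P × ℝ) → ℝ} (hf : IsPrimitiveOn lam L f) {C a b s₀ : ℝ} (hab : a < b) (hs₀ : s₀ ≤ a)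
    (hC : ∀ x ∈ L, x.1 ∈ Set.Icc a b → f x = C) (h0 : ∀ x ∈ L, x.1 < s₀ → f x = 0)
    (hcl : IsClosed L) (hcpt : IsCompact (L ∩ {x | x.1 ∈ Set.Icc s₀ b})) :
    ∃ a' ∈ Set.Ioo a b, ∃ T > (0 : ℝ), T < b - a' ∧ ∃ Φ : ℝ × (P × ℝ) → ℝ × (P × ℝ),
      (∀ x, IsConformalAt (modelX m) (sympPrimitive lam) 1 Φ x) ∧ Function.Injective Φ ∧
      (∀ x, a' < x.1 → Φ x = x) ∧
      ∀ x : ℝ × (P × ℝ), x.1 < b - T → (Φ x ∈ L ↔ (x.1 + T, x.2) ∈ L) := by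
  have hθ := isSmooth_sympPrimitive hlam.smooth
  have hnd := isNondegenerate_sympPrimitive hlam
  obtain ⟨a', ha', h, hh, hfh, k, hk, hconst, K, hK, hkK⟩ :=
    exists_hamiltonian hf.smooth hab hs₀ hC h0 hcl hcpt
  obtain ⟨Z, hZ⟩ := exists_liouvilleField (θ := sympPrimitive lam) (h := h) hθ hnd hh
  obtain ⟨T₀, hT₀, F, hF⟩ := exists_symplectization_flow hlam hh hZ hk hK hkK
  obtain ⟨T, hT, hTT⟩ := exists_between (lt_min hT₀ (sub_pos.2 ha'.2))
  obtain ⟨hTT₀, hTb⟩ := lt_min_iff.1 hTT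
  -- If the trajectory is above `a'` at time `r` and its vertical continuation is above `a'` at time
  -- `t`, the motion between is vertical. The interval is cut on the left at the time when the
  -- vertical line would cross `a'`.
  have hvert : ∀ (x : ℝ × (P × ℝ)) (r t : ℝ), r ∈ Set.Ioo (-T₀) T₀ → t ∈ Set.Ioo (-T₀) T₀ →
      a' < (F r x).1 → a' < (F r x).1 + (t - r) → F t x = ((F r x).1 + (t - r), (F r x).2) := by
    intro x r t hr ht h1 h2
    refine integralCurve_eq_vertical hlam hh hZ (a' := a') (α := max (-T₀) (r + (a' - (F r x).1)))
      (β := T₀) (fun y hy => ⟨C, hconst y hy⟩) ((hF.curve x trivial).mono ?_)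
      ⟨max_lt hr.1 (by linarith), hr.2⟩ ⟨max_lt ht.1 (by linarith), ht.2⟩ ?_
    · exact Set.Ioo_subset_Ioo_left (le_max_left _ _)
    · have := le_max_right (-T₀) (r + (a' - (F r x).1))
      linarith
  have h0mem : (0 : ℝ) ∈ Set.Ioo (-T₀) T₀ := ⟨by linarith, hT₀⟩
  have hTmem : -T ∈ Set.Ioo (-T₀) T₀ := ⟨by linarith, by linarith⟩
  set τ : ℝ × (P × ℝ) → ℝ × (P × ℝ) := shiftShear P T (fun _ => 0) with hτ
  have hτx : ∀ x, τ x = (x.1 + T, x.2) := fun x => by simp [hτ, shiftShear]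
  -- The slide is `F_{-T} ∘ τ_T`; the factors `e^{-T}` and `e^T` cancel, so it is symplectic.
  refine ⟨a', ha', T, hT, hTb, F (-T) ∘ τ, ?_, ?_, ?_, ?_⟩
  · intro x
    have h1 := (hF.conformal (τ x) trivial (-T) hTmem).comp
      (isConformalAt_shiftShear hlam.smooth T contDiff_const x)
    rwa [← Real.exp_add, neg_add_cancel, Real.exp_zero] at h1
  · have hFinj : Function.Injective (F (-T)) := by
      intro x y hxy
      have := integralCurve_eqOn hθ hnd hh hZ hTmem (hF.curve x trivial) (hF.curve y trivial) hxy
        h0mem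
      simpa only [hF.zero x trivial, hF.zero y trivial] using this
    refine hFinj.comp fun x y hxy => ?_
    rw [hτx, hτx, Prod.mk.injEq, add_left_inj] at hxy
    exact Prod.ext hxy.1 hxy.2
  · intro x hx
    have hz : F 0 (τ x) = (x.1 + T, x.2) := by rw [hF.zero _ trivial, hτx]
    have h1 := hvert (τ x) 0 (-T) h0mem hTmem (by rw [hz]; simp only; linarith)
      (by rw [hz]; simp only; linarith)
    rw [Function.comp_apply, h1, hz]
    refine Prod.ext ?_ rfl
    simp only
    ring
  · intro x hx
    have hz : F 0 (τ x) = (x.1 + T, x.2) := by rw [hF.zero _ trivial, hτx]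
    have hO : IsOpen {y : ℝ × (P × ℝ) | y.1 < b} := isOpen_lt continuous_fst continuous_const
    -- Were the trajectory at level `b` or higher at a time `r ≤ 0`, vertical motion would keep it
    -- at least as high at time `0`, where its level is `x.1 + T < b`.
    have hlevel : ∀ r ∈ Set.Icc (-T) 0, (F r (τ x)).1 < b := by
      intro r hr
      by_contra! hlt
      have h1 := hvert (τ x) r 0 ⟨by linarith [hr.1], by linarith [hr.2]⟩ h0mem
        (by linarith [ha'.2]) (by linarith [ha'.2, hr.2])
      rw [hz] at h1
      have h2 := congrArg Prod.fst h1
      simp only at h2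
      linarith [hr.2]
    -- The trajectory stays below `b`, where `h` is a primitive on `L`, so invariance of `L` holds
    -- in both time directions.
    have hmem : ∀ s ∈ Set.Icc (-T) 0, ∀ t ∈ Set.Icc (-T) 0, F s (τ x) ∈ L → F t (τ x) ∈ L := by
      intro s hs t ht
      refine mem_lagrangian_of_integralCurve (γ := fun t => F t (τ x)) hθ hnd hh hZ
        (finrank_vecX m) hcl hL.submanifold
        hL.isotropic hO
        (fun y hy v hv => differential_eq_of_eqOn hf hh hfh hy.1 hy.2 hv)
        (hF.curve (τ x) trivial)
        ⟨by linarith [hs.1], by linarith [hs.2]⟩ ⟨by linarith [ht.1], by linarith [ht.2]⟩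
        fun r hr => hlevel r (Set.ordConnected_Icc.uIcc_subset hs ht hr)
    have e1 : (-T : ℝ) ∈ Set.Icc (-T) 0 := ⟨le_rfl, by linarith⟩
    have e2 : (0 : ℝ) ∈ Set.Icc (-T) 0 := ⟨by linarith, le_rfl⟩
    rw [← hz]
    exact ⟨hmem _ e1 _ e2, hmem _ e2 _ e1⟩

end SlideStep

/-! ### Iterated slides and the width inequality -/

section Slide

variable {m : ℕ} {P : Type*} [TopologicalSpace P]
  [ChartedSpace (EuclideanSpace ℝ (Fin (2 * m))) P] [IsManifold (modelP m) ∞ P]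
  {lam : OneForm (modelP m) P}

/-- If `y = Φ x` were above `a'`, then `Φ y = y = Φ x` would force `x = y`. -/
lemma level_le_of_injective {Φ : ℝ × (P × ℝ) → ℝ × (P × ℝ)} {a' : ℝ}
    (hinj : Function.Injective Φ) (hid : ∀ x, a' < x.1 → Φ x = x) {x : ℝ × (P × ℝ)}
    (hx : x.1 ≤ a') : (Φ x).1 ≤ a' := by
  by_contra! hlt
  have h1 := hinj (hid _ hlt)
  rw [h1] at hlt
  exact absurd hx (not_le.2 hlt)

lemma level_lt_of_injective {Φ : ℝ × (P × ℝ) → ℝ × (P × ℝ)} {a' b : ℝ} (hb : a' < b)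
    (hinj : Function.Injective Φ) (hid : ∀ x, a' < x.1 → Φ x = x) {x : ℝ × (P × ℝ)}
    (hx : x.1 < b) : (Φ x).1 < b := by
  rcases le_or_gt x.1 a' with h | h
  · exact (level_le_of_injective hinj hid h).trans_lt hb
  · rwa [hid x h]

/-- Iterating a small slide straightens `L` below the cylindrical piece over `[a, b]`, down to any
prescribed level. -/
lemma exists_iterated_slide (hlam : OneForm.IsSmooth (modelP m) lam) {L : Set (ℝ × (P × ℝ))}
    {Lam : Set (P × ℝ)} {a a' b T : ℝ} (ha' : a' ∈ Set.Ioo a b)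
    (hcyl : ∀ x : ℝ × (P × ℝ), x.1 ∈ Set.Icc a b → (x ∈ L ↔ x.2 ∈ Lam))
    (hTb : T < b - a') {Φ : ℝ × (P × ℝ) → ℝ × (P × ℝ)}
    (hΦ : ∀ x, IsConformalAt (modelX m) (sympPrimitive lam) 1 Φ x)
    (hinj : Function.Injective Φ) (hid : ∀ x, a' < x.1 → Φ x = x)
    (hΦL : ∀ x : ℝ × (P × ℝ), x.1 < b - T → (Φ x ∈ L ↔ (x.1 + T, x.2) ∈ L)) (hT : 0 < T) (n : ℕ) :
    ∃ Ψ : ℝ × (P × ℝ) → ℝ × (P × ℝ),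
      (∀ x, IsConformalAt (modelX m) (sympPrimitive lam) 1 Ψ x) ∧ Function.Injective Ψ ∧
      (∀ x, a' < x.1 → Ψ x = x) ∧
      ∀ x : ℝ × (P × ℝ), a - n * T < x.1 → x.1 < b → (Ψ x ∈ L ↔ x.2 ∈ Lam) := by
  have hshift : ∀ (c : ℝ) (x : ℝ × (P × ℝ)), shiftShear P c (fun _ => 0) x = (x.1 + c, x.2) :=
    fun c x => by simp [shiftShear]
  have hshift_inj : ∀ c : ℝ, Function.Injective (shiftShear P c (fun _ => 0)) := by
    intro c x y hxy
    rw [hshift, hshift, Prod.mk.injEq, add_left_inj] at hxy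
    exact Prod.ext hxy.1 hxy.2
  induction n with
  | zero =>
    refine ⟨id, fun x => ?_, Function.injective_id, fun x _ => rfl, fun x h1 h2 => ?_⟩
    · have h1 := isConformalAt_shiftShear hlam 0 (contDiff_const (c := (0 : ℝ))) x
      rw [Real.exp_zero] at h1
      refine h1.congr (Filter.Eventually.of_forall fun y => ?_)
      rw [hshift, add_zero, id]
    · exact hcyl x ⟨by simpa using h1.le, h2.le⟩
  | succ n ih =>
    obtain ⟨Ψ, hΨ, hΨinj, hΨid, hΨL⟩ := ih
    have hval : ∀ x, (Φ ∘ shiftShear P (-T) (fun _ => 0) ∘ Ψ ∘ shiftShear P T (fun _ => 0)) x =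
        Φ ((Ψ (x.1 + T, x.2)).1 + -T, (Ψ (x.1 + T, x.2)).2) := by
      intro x
      simp only [Function.comp_apply, hshift]
    have hfix : ∀ x : ℝ × (P × ℝ), a' < x.1 + T →
        (Φ ∘ shiftShear P (-T) (fun _ => 0) ∘ Ψ ∘ shiftShear P T (fun _ => 0)) x = Φ x := by
      intro x hx
      rw [hval, hΨid _ hx]
      simp
    -- The previous map is conjugated by the translation, which moves its straightened range down by
    -- `T` and makes it land in `τ_T⁻¹(L)`; then `Φ` carries this to `L`.
    refine ⟨Φ ∘ shiftShear P (-T) (fun _ => 0) ∘ Ψ ∘ shiftShear P T (fun _ => 0), ?_, ?_, ?_, ?_⟩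
    · intro x
      have h1 := (hΦ _).comp ((isConformalAt_shiftShear hlam (-T)
        (contDiff_const (c := (0 : ℝ))) _).comp
        ((hΨ _).comp (isConformalAt_shiftShear hlam T (contDiff_const (c := (0 : ℝ))) x)))
      rwa [one_mul, one_mul, ← Real.exp_add, neg_add_cancel, Real.exp_zero] at h1
    · exact hinj.comp ((hshift_inj _).comp (hΨinj.comp (hshift_inj _)))
    · intro x hx
      rw [hfix x (by linarith), hid x hx]
    · intro x h1 h2
      -- If `x.1 + T < b` the inductive hypothesis applies at the translated point. Otherwise `x.1 ≥
      -- b - T > a'`, the new map fixes `x`, and `x` lies over the cylindrical piece.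
      rcases lt_or_ge (x.1 + T) b with h3 | h3
      · have h4 : (Ψ (x.1 + T, x.2)).1 < b := level_lt_of_injective ha'.2 hΨinj hΨid h3
        rw [hval, hΦL _ (by simp only; linarith), neg_add_cancel_right]
        refine hΨL (x.1 + T, x.2) ?_ h3
        push_cast at h1
        simp only
        linarith
      · rw [hfix x (by linarith [ha'.2]), hid x (by linarith)]
        exact hcyl x ⟨by linarith [ha'.1], h2.le⟩

/-- The width of a cylinder below level `b` is at most that of an exact Lagrangian containing a
cylindrical piece with top level `b`. -/
theorem relWidth_cyl_le [T2Space P] [SecondCountableTopology P] (hlam : IsLiouvilleForm lam)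
    {L : Set (ℝ × (P × ℝ))} (hL : IsLagrangian lam L) {f : ℝ × (P × ℝ) → ℝ}
    (hf : IsPrimitiveOn lam L f) {C a b s₀ : ℝ} (hab : a < b) (hs₀ : s₀ ≤ a)
    (hC : ∀ x ∈ L, x.1 ∈ Set.Icc a b → f x = C) (h0 : ∀ x ∈ L, x.1 < s₀ → f x = 0)
    (hcl : IsClosed L) (hcpt : IsCompact (L ∩ {x | x.1 ∈ Set.Icc s₀ b})) {Lam : Set (P × ℝ)}
    (hcyl : L ∩ (Set.Icc a b ×ˢ Set.univ) = Set.Icc a b ×ˢ Lam) {b' : EReal} (hb : b ≤ b') :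
    relWidth lam ⊥ (b : EReal) (cyl Lam) ≤ relWidth lam ⊥ b' L := by
  obtain ⟨a', ha', T, hT, hTb, Φ, hΦ, hinj, hid, hΦL⟩ :=
    exists_slide hlam hL hf hab hs₀ hC h0 hcl hcpt
  have hmem : ∀ x : ℝ × (P × ℝ), x.1 ∈ Set.Icc a b → (x ∈ L ↔ x.2 ∈ Lam) := fun x hx =>
    ⟨fun h => (hcyl.subset ⟨h, hx, trivial⟩).2, fun h => (hcyl.symm.subset ⟨hx, h⟩).1⟩
  have key := relWidth_le_of_transfer (lam := lam) (b := (b : EReal)) (b' := b') (L := cyl Lam)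
    (L' := L) one_pos fun r hr ψ hψ => by
      have hbdd : BddBelow ((fun w => (ψ w).1) '' Metric.closedBall (0 : StdSpace (m + 1)) r) :=
        ((isCompact_closedBall _ _).image_of_continuousOn
          (continuous_fst.comp_continuousOn hψ.smooth.continuousOn)).bddBelow
      obtain ⟨c, hc⟩ := hbdd
      -- With `c` a lower bound for the levels of the compact ball, this `n` gives `a - n T < c`, so
      -- the whole ball lies in the straightened range.
      obtain ⟨n, hn⟩ := exists_nat_gt ((a - c) / T)
      rw [div_lt_iff₀ hT] at hn
      obtain ⟨Ψ, hΨ, hΨinj, hΨid, hΨL⟩ :=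
        exists_iterated_slide hlam.smooth ha' hmem hTb hΦ hinj hid hΦL hT n
      have hlev : ∀ w ∈ Metric.closedBall (0 : StdSpace (m + 1)) r, (ψ w).1 < b := fun w hw =>
        EReal.coe_lt_coe_iff.1 (hψ.mapsTo hw).2
      refine ⟨_, hψ.transfer hr one_pos (by norm_num) hΨ hΨinj (fun w hw => ?_) fun w hw => ?_⟩
      · exact ⟨EReal.bot_lt_coe _, (EReal.coe_lt_coe_iff.2
          (level_lt_of_injective ha'.2 hΨinj hΨid (hlev w hw))).trans_le hb⟩
      · have h1 : c ≤ (ψ w).1 := hc ⟨w, hw, rfl⟩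
        rw [hΨL _ (by linarith) (hlev w hw)]
        simp [cyl]
  simpa using key

end Slide

/-! ### Application to cobordisms -/

section Cobordism

variable {m : ℕ} {P : Type*} [TopologicalSpace P]
  [ChartedSpace (EuclideanSpace ℝ (Fin (2 * m))) P] {lam : OneForm (modelP m) P}
  {Lamneg Lampos : Set (P × ℝ)} {sneg spos : ℝ} {L : Set (ℝ × (P × ℝ))}

lemma IsLagrangianCobordism.isCompact_inter_Icc
    (hL : IsLagrangianCobordism lam Lamneg Lampos sneg spos L) (s t : ℝ) :
    IsCompact (L ∩ {x | x.1 ∈ Set.Icc s t}) := by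
  refine ((hL.compact_middle.union ((isCompact_Icc (a := s) (b := sneg)).prod
    hL.legendrian_neg.compact)).union ((isCompact_Icc (a := spos) (b := t)).prod
    hL.legendrian_pos.compact)).of_isClosed_subset
    (hL.closed.inter (isClosed_Icc.preimage continuous_fst)) ?_
  rintro x ⟨hx, hs, ht⟩
  rcases le_total x.1 sneg with h | h
  · exact Or.inl (Or.inr ⟨⟨hs, h⟩, (hL.cylinder_neg.subset ⟨hx, h, trivial⟩).2⟩)
  · rcases le_total x.1 spos with h' | h'
    · exact Or.inl (Or.inl ⟨hx, h, h'⟩)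
    · exact Or.inr ⟨⟨h', ht⟩, (hL.cylinder_pos.subset ⟨hx, h', trivial⟩).2⟩

lemma IsLagrangianCobordism.relWidth_cyl_le [T2Space P] [SecondCountableTopology P]
    [IsManifold (modelP m) ∞ P] (hlam : IsLiouvilleForm lam)
    (hL : IsLagrangianCobordism lam Lamneg Lampos sneg spos L) {f : ℝ × (P × ℝ) → ℝ}
    (hf : IsPrimitiveOn lam L f) (h0 : ∀ x ∈ L, x.1 ≤ sneg → f x = 0) {C a b : ℝ} (hab : a < b)
    (hC : ∀ x ∈ L, x.1 ∈ Set.Icc a b → f x = C) {Lam : Set (P × ℝ)}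
    (hcyl : L ∩ (Set.Icc a b ×ˢ Set.univ) = Set.Icc a b ×ˢ Lam) {b' : EReal} (hb : b ≤ b') :
    relWidth lam ⊥ (b : EReal) (cyl Lam) ≤ relWidth lam ⊥ b' L :=
  -- The level `s₀ = min sneg a` allows the cylindrical piece to lie inside the negative end.
  _root_.relWidth_cyl_le hlam hL.lagrangian hf hab (min_le_right sneg a) hC
    (fun x hx h => h0 x hx (h.le.trans (min_le_left _ _))) hL.closed
    (hL.isCompact_inter_Icc _ _) hcyl hb

end Cobordism

end

theorem theorem3p4 {m : ℕ} {P : Type*} [TopologicalSpace P] [T2Space P]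
    [SecondCountableTopology P] [ChartedSpace (EuclideanSpace ℝ (Fin (2 * m))) P]
    [IsManifold (modelP m) ∞ P] (lam : OneForm (modelP m) P) (hlam : IsLiouvilleForm lam) :
    -- a cylindrical piece anywhere below level `0`
    (∀ (Lamneg Lampos : Set (P × ℝ)) (sneg : ℝ) (L : Set (ℝ × (P × ℝ))),
      IsLagrangianCobordism lam Lamneg Lampos sneg 0 L →
      ∀ (a b : ℝ) (Lam : Set (P × ℝ)), a < b → b ≤ 0 → IsClosedLegendrian lam Lam →
      L ∩ (Set.Icc a b ×ˢ Set.univ) = Set.Icc a b ×ˢ Lam →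
      (IsPreconnected Lam ∨
        ∃ (f : ℝ × (P × ℝ) → ℝ) (C : ℝ), IsPrimitiveOn lam L f ∧
          (∀ x ∈ L, x.1 ≤ sneg → f x = 0) ∧ (∀ x ∈ L, x.1 ∈ Set.Icc a b → f x = C)) →
      relWidth lam ⊥ (b : EReal) (cyl Lam) ≤ relWidth lam ⊥ 0 L) ∧
    -- the scaling law for cylinders
    (∀ (Lam : Set (P × ℝ)) (b : ℝ), IsClosedLegendrian lam Lam →
      relWidth lam ⊥ (b : EReal) (cyl Lam) =
        ENNReal.ofReal (Real.exp b) * relWidth lam ⊥ 0 (cyl Lam)) ∧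
    -- comparison with the negative end
    (∀ (Lamneg Lampos : Set (P × ℝ)) (sneg : ℝ) (L : Set (ℝ × (P × ℝ))),
      IsLagrangianCobordism lam Lamneg Lampos sneg 0 L →
      ENNReal.ofReal (Real.exp sneg) * relWidth lam ⊥ 0 (cyl Lamneg) ≤ relWidth lam ⊥ 0 L) ∧
    -- comparison with the positive end, for cobordisms that are collared near the top
    (∀ (Lamneg Lampos : Set (P × ℝ)) (sneg ε : ℝ) (L : Set (ℝ × (P × ℝ))), 0 < ε →
      IsLagrangianCobordism lam Lamneg Lampos sneg (-ε) L →
      relWidth lam ⊥ 0 (cyl Lampos) ≤ relWidth lam ⊥ 0 L) := by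
  refine ⟨?_, fun Lam b _ => relWidth_cyl_eq hlam.smooth Lam b, ?_, ?_⟩
  · intro Lamneg Lampos sneg L hL a b Lam hab hb hLam hcyl hex
    obtain ⟨f, C, hf, h0, hC⟩ : ∃ (f : ℝ × (P × ℝ) → ℝ) (C : ℝ), IsPrimitiveOn lam L f ∧
        (∀ x ∈ L, x.1 ≤ sneg → f x = 0) ∧ (∀ x ∈ L, x.1 ∈ Set.Icc a b → f x = C) := by
      rcases hex with hconn | hex
      · obtain ⟨f, -, hf, h0, -⟩ := hL.exact
        obtain ⟨C, hC⟩ := exists_primitive_eq_const hf hLam hab hcyl hconn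
        exact ⟨f, C, hf, h0, hC⟩
      · exact hex
    exact hL.relWidth_cyl_le hlam hf h0 hab hC hcyl (EReal.coe_nonpos.2 hb)
  -- By the scaling law the left side is the width of the negative cylinder below `sneg`. The piece
  -- is the part of the negative end over `[sneg - 1, sneg]`, where the primitive is `0`, so no
  -- connectedness is needed.
  · intro Lamneg Lampos sneg L hL
    obtain ⟨f, -, hf, h0, -⟩ := hL.exact
    rw [← relWidth_cyl_eq hlam.smooth]
    refine hL.relWidth_cyl_le hlam hf h0 (sub_one_lt sneg) (C := 0) (fun x hx h => h0 x hx h.2) ?_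
      (EReal.coe_nonpos.2 hL.le)
    ext x
    constructor
    · rintro ⟨hx, h, -⟩
      exact ⟨h, (hL.cylinder_neg.subset ⟨hx, h.2, trivial⟩).2⟩
    · rintro ⟨h, hx⟩
      exact ⟨(hL.cylinder_neg.symm.subset ⟨h.2, hx⟩).1, h, trivial⟩
  · intro Lamneg Lampos sneg ε L hε hL
    obtain ⟨f, C, hf, h0, hC⟩ := hL.exact
    -- The piece is the collar over `[-ε, 0]` of the positive end, an interval of positive length on
    -- which the primitive is constant.
    have h1 := hL.relWidth_cyl_le hlam hf h0 (a := -ε) (b := 0) (Lam := Lampos) (b' := 0)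
      (by linarith) (fun x hx h => hC x hx h.1) ?_ (by simp)
    · rwa [EReal.coe_zero] at h1
    ext x
    constructor
    · rintro ⟨hx, h, -⟩
      exact ⟨h, (hL.cylinder_pos.subset ⟨hx, h.1, trivial⟩).2⟩
    · rintro ⟨h, hx⟩
      exact ⟨(hL.cylinder_pos.symm.subset ⟨h.1, hx⟩).1, h, trivial⟩
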